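/- Let $m,l\in\mathbb R$, $F=1+m(x^2+y^2)$, and let $$M^3(m,l)=\Big(\{F\neq0\}\subset\mathbb R^3,\ h=\frac{dx^2+dy^2}{F^2}+\Big[dz+\frac l2\,\frac{y\,dx-x\,dy}{F}\Big]^2\Big)$$ be the BCV space, with the Riemannian submersion $\pi(x,y,z)=(x,y)$ onto $\big(\{F\neq 0\}\subset\mathbb R^2,\ h_1=(dx^2+dy^2)/F^2\big)$. Let $I,J\subseteq\mathbb R$ be open intervals, $\gamma=(x,y):I\to(\mathbb R^2,h_1)$ a smooth curve parametrized by arclength (with $F\ne0$ along $\gamma$), and $\varphi:\Sigma=I\times J\to M^3(m,l)$, $\varphi(s,z)=(x(s),y(s),z)$, the Hopf cylinder over $\gamma$; $J=\mathbb R$ is the full Hopf cylinder $\bigcup_{s\in I}\pi^{-1}(\gamma(s))$. Let $\kappa$ be the signed geodesic curvature of $\gamma$ in $(\mathbb R^2,h_1)$ with respect to the unit normal $y'\partial_x-x'\partial_y$, and let $H$ be the mean curvature of $\varphi$ with respect to the unit normal $\xi=\frac{y'}{F}E_1-\frac{x'}{F}E_2$, where $E_1=F\partial_x-\frac{ly}2\partial_z$,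 $E_2=F\partial_y+\frac{lx}2\partial_z$. A map is biharmonic if its bitension field $$\tau_2(\varphi)=\mathrm{Trace}_g(\nabla^\varphi\nabla^\varphi-\nabla^\varphi_{\nabla^M})\tau(\varphi)-\mathrm{Trace}_g R^N(d\varphi,\tau(\varphi))d\varphi$$ vanishes, where $\tau(\varphi)=\mathrm{Trace}_g\nabla d\varphi$, and proper biharmonic if moreover $\tau(\varphi)\not\equiv0$. **Theorem.** Let $f:\Sigma\to(0,\infty)$ be smooth such that $f^{1/2}$ is nonconstant and the conformal immersion $\varphi:(\Sigma,\bar g=f^{-1}\varphi^*h)\to M^3(m,l)$ is proper biharmonic. Then $l=0$, $H(s,z)=\kappa(s)/2$ on $\Sigma$, and one of the following holds. (i) $\kappa$ is a nonzero constant with $\kappa^2-4m>0$, and $f=d_1e^{z\sqrt{\kappa^2-4m}}+d_2e^{-z\sqrt{\kappa^2-4m}}$ with constants $d_1,d_2$, $d_1^2+d_2^2\ne0$. (ii) $\kappa$ is nonconstant and nowhere zero, and there is a constant $K$ such that $f(s,z)=\psi(z)\,|\kappa(s)|^{-3/2}$, where $\psi>0$ on $J$ and $$|\kappa(s)|=\begin{cases}\dfrac1{C_1e^{2\sqrt{-(4m+K)}\,s}+D_1e^{-2\sqrt{-(4m+K)}\,s}+\varepsilon\sqrt{4C_1D_1+\frac1{4m+K}}},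 & 4m+K<0,\\[3mm] \dfrac{4C_2}{16+C_2^2(s+D_2)^2}, & 4m+K=0,\\[3mm] \dfrac1{C_3\cos(2\sqrt{4m+K}\,s)+D_3\sin(2\sqrt{4m+K}\,s)+\sqrt{\frac1{4m+K}+C_3^2+D_3^2}}, & 4m+K>0,\end{cases}$$ $$\psi(z)=\begin{cases}a_3\sin(\sqrt{-K}\,z)+b_3\cos(\sqrt{-K}\,z), & K<0,\\ a_2z+b_2, & K=0,\\ a_1e^{\sqrt K z}+b_1e^{-\sqrt K z}, & K>0,\end{cases}$$ with real constants $a_i,b_i,C_i,D_i$, a sign $\varepsilon\in\{1,-1\}$, and $4C_1D_1+\frac1{4m+K}\ge0$ in the first case. (iii) (Only if $J\neq\mathbb R$, i.e. never for a full Hopf cylinder.) $\kappa$ is a nonzero constant with $\kappa^2-4m\le0$, and $f(s,z)=\psi(z)$ with $\psi$ as in the table above for $K=\kappa^2-4m$. -/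

import Mathlib

open scoped ContDiff

noncomputable section

namespace HopfBCV

/-! ### Riemannian geometry in coordinates

A Riemannian metric on an open subset of `ℝⁿ` is given by its coefficient matrix `g p`.
Vectors and vector fields along maps are given by their coordinate components. -/

/-- The partial derivative `∂ᵢ u` at `p`. -/
def pd {d : ℕ} (i : Fin d) (u : (Fin d → ℝ) → ℝ) (p : Fin d → ℝ) : ℝ :=
  fderiv ℝ u p (Pi.single i 1)

/-- The Riemannian inner product `⟨v, w⟩` at `p`. -/
def ip {n : ℕ} (h : (Fin n → ℝ) → Matrix (Fin n) (Fin n) ℝ) (p v w : Fin n → ℝ) : ℝ :=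
  ∑ a, ∑ b, h p a b * v a * w b

/-- The Christoffel symbol `Γᵏᵢⱼ` of the metric `g` at `p`. -/
def christoffel {n : ℕ} (g : (Fin n → ℝ) → Matrix (Fin n) (Fin n) ℝ)
    (k i j : Fin n) (p : Fin n → ℝ) : ℝ :=
  (1 / 2) * ∑ r, (g p)⁻¹ k r *
    (pd i (fun q => g q j r) p + pd j (fun q => g q i r) p - pd r (fun q => g q i j) p)

/-- The coefficient `Rᵃ_{c i j}` of the curvature operator
`R(X,Y)Z = [∇_X,∇_Y]Z - ∇_{[X,Y]}Z`, i.e. `R(∂ᵢ,∂ⱼ)∂_c = ∑ₐ Rᵃ_{c i j} ∂ₐ`. -/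
def curvature {n : ℕ} (h : (Fin n → ℝ) → Matrix (Fin n) (Fin n) ℝ)
    (a c i j : Fin n) (p : Fin n → ℝ) : ℝ :=
  pd i (christoffel h a j c) p - pd j (christoffel h a i c) p
    + ∑ e, (christoffel h a i e p * christoffel h e j c p
      - christoffel h a j e p * christoffel h e i c p)

/-- The vector `R(X,Y)Z` at `p`. -/
def curvatureOp {n : ℕ} (h : (Fin n → ℝ) → Matrix (Fin n) (Fin n) ℝ)
    (p X Y Z : Fin n → ℝ) (a : Fin n) : ℝ :=
  ∑ i, ∑ j, ∑ c, curvature h a c i j p * X i * Y j * Z c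

/-- The vector field `dφ(∂ᵢ)` along `φ`. -/
def dmap {d n : ℕ} (φ : (Fin d → ℝ) → (Fin n → ℝ)) (i : Fin d) (p : Fin d → ℝ) :
    Fin n → ℝ :=
  fun a => pd i (fun q => φ q a) p

/-- The pulled-back connection: `∇^φ_{∂ᵢ} V` for a vector field `V` along `φ`. -/
def covAlong {d n : ℕ} (h : (Fin n → ℝ) → Matrix (Fin n) (Fin n) ℝ)
    (φ : (Fin d → ℝ) → (Fin n → ℝ)) (i : Fin d) (V : (Fin d → ℝ) → (Fin n → ℝ))
    (p : Fin d → ℝ) : Fin n → ℝ :=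
  fun a => pd i (fun q => V q a) p
    + ∑ b, ∑ c, christoffel h a b c (φ p) * dmap φ i p b * V p c

/-- The tension field `τ(φ) = Trace_g ∇dφ` of `φ : (M, g) → (N, h)`. -/
def tension {d n : ℕ} (g : (Fin d → ℝ) → Matrix (Fin d) (Fin d) ℝ)
    (h : (Fin n → ℝ) → Matrix (Fin n) (Fin n) ℝ) (φ : (Fin d → ℝ) → (Fin n → ℝ))
    (p : Fin d → ℝ) : Fin n → ℝ :=
  fun a => ∑ i, ∑ j, (g p)⁻¹ i j *
    (covAlong h φ i (dmap φ j) p a - ∑ k, christoffel g k i j p * dmap φ k p a)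

/-- The bitension field
`τ₂(φ) = Trace_g (∇^φ ∇^φ - ∇^φ_{∇^M}) τ(φ) - Trace_g R^N(dφ, τ(φ)) dφ`. -/
def bitension {d n : ℕ} (g : (Fin d → ℝ) → Matrix (Fin d) (Fin d) ℝ)
    (h : (Fin n → ℝ) → Matrix (Fin n) (Fin n) ℝ) (φ : (Fin d → ℝ) → (Fin n → ℝ))
    (p : Fin d → ℝ) : Fin n → ℝ :=
  fun a => ∑ i, ∑ j, (g p)⁻¹ i j *
    (covAlong h φ i (covAlong h φ j (tension g h φ)) p a
      - (∑ k, christoffel g k i j p * covAlong h φ k (tension g h φ) p a)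
      - curvatureOp h (φ p) (dmap φ i p) (tension g h φ p) (dmap φ j p) a)

/-- `φ : (U, g) → (N, h)` is harmonic. -/
def IsHarmonicMap {d n : ℕ} (U : Set (Fin d → ℝ))
    (g : (Fin d → ℝ) → Matrix (Fin d) (Fin d) ℝ)
    (h : (Fin n → ℝ) → Matrix (Fin n) (Fin n) ℝ) (φ : (Fin d → ℝ) → (Fin n → ℝ)) : Prop :=
  ∀ p ∈ U, tension g h φ p = 0

/-- `φ : (U, g) → (N, h)` is biharmonic. -/
def IsBiharmonicMap {d n : ℕ} (U : Set (Fin d → ℝ))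
    (g : (Fin d → ℝ) → Matrix (Fin d) (Fin d) ℝ)
    (h : (Fin n → ℝ) → Matrix (Fin n) (Fin n) ℝ) (φ : (Fin d → ℝ) → (Fin n → ℝ)) : Prop :=
  ∀ p ∈ U, bitension g h φ p = 0

/-- `φ : (U, g) → (N, h)` is proper biharmonic: biharmonic and not harmonic. -/
def IsProperBiharmonicMap {d n : ℕ} (U : Set (Fin d → ℝ))
    (g : (Fin d → ℝ) → Matrix (Fin d) (Fin d) ℝ)
    (h : (Fin n → ℝ) → Matrix (Fin n) (Fin n) ℝ) (φ : (Fin d → ℝ) → (Fin n → ℝ)) : Prop :=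
  IsBiharmonicMap U g h φ ∧ ¬ IsHarmonicMap U g h φ

/-- The pull-back metric `φ^*h`. -/
def pullbackMetric {d n : ℕ} (h : (Fin n → ℝ) → Matrix (Fin n) (Fin n) ℝ)
    (φ : (Fin d → ℝ) → (Fin n → ℝ)) (p : Fin d → ℝ) : Matrix (Fin d) (Fin d) ℝ :=
  Matrix.of fun i j => ip h (φ p) (dmap φ i p) (dmap φ j p)

/-- The mean curvature `½ Trace_g ⟨∇dφ, ξ⟩`, `g = φ^*h`, of the surface `φ` with respect to
the unit normal field `ξ` along `φ`. -/
def meanCurvature {n : ℕ} (h : (Fin n → ℝ) → Matrix (Fin n) (Fin n) ℝ)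
    (φ ξ : (Fin 2 → ℝ) → (Fin n → ℝ)) (p : Fin 2 → ℝ) : ℝ :=
  (1 / 2) * ∑ i, ∑ j, (pullbackMetric h φ p)⁻¹ i j *
    ip h (φ p) (covAlong h φ i (dmap φ j) p) (ξ p)

/-- The velocity `c'(s)` of a curve. -/
def vel {n : ℕ} (c : ℝ → (Fin n → ℝ)) (s : ℝ) : Fin n → ℝ :=
  fun a => deriv (fun t => c t a) s

/-- The covariant acceleration `∇_{c'} c'` of a curve. -/
def covAccel {n : ℕ} (h : (Fin n → ℝ) → Matrix (Fin n) (Fin n) ℝ)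
    (c : ℝ → (Fin n → ℝ)) (s : ℝ) : Fin n → ℝ :=
  fun a => deriv (fun t => vel c t a) s
    + ∑ i, ∑ j, christoffel h a i j (c s) * vel c s i * vel c s j

/-! ### BCV spaces and Hopf cylinders -/

/-- `F = 1 + m (x² + y²)`. -/
def conf (m x y : ℝ) : ℝ := 1 + m * (x ^ 2 + y ^ 2)

/-- The metric `(dx² + dy²) / F²` of the base surface. -/
def baseMetric (m : ℝ) (p : Fin 2 → ℝ) : Matrix (Fin 2) (Fin 2) ℝ :=
  !![1 / conf m (p 0) (p 1) ^ 2, 0; 0, 1 / conf m (p 0) (p 1) ^ 2]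

/-- The rows are the one-forms `dx / F`, `dy / F`, `dz + (l/2) (y dx - x dy) / F`. -/
def bcvCoframe (m l : ℝ) (p : Fin 3 → ℝ) : Matrix (Fin 3) (Fin 3) ℝ :=
  !![1 / conf m (p 0) (p 1), 0, 0;
     0, 1 / conf m (p 0) (p 1), 0;
     l / 2 * p 1 / conf m (p 0) (p 1), -(l / 2 * p 0 / conf m (p 0) (p 1)), 1]

/-- The metric of the BCV space `M³(m, l)`: the sum of the squares of the coframe forms. -/
def bcvMetric (m l : ℝ) (p : Fin 3 → ℝ) : Matrix (Fin 3) (Fin 3) ℝ :=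
  (bcvCoframe m l p).transpose * bcvCoframe m l p

/-- The parameter domain `I × J` of the surface, with coordinates `s = p 0`, `z = p 1`. -/
def cylinderDomain (I J : Set ℝ) : Set (Fin 2 → ℝ) := {p | p 0 ∈ I ∧ p 1 ∈ J}

/-- The Hopf cylinder `φ(s, z) = (x(s), y(s), z)` over the curve `γ = (x, y)`. -/
def hopfCylinder (γ : ℝ → (Fin 2 → ℝ)) (p : Fin 2 → ℝ) : Fin 3 → ℝ :=
  ![γ (p 0) 0, γ (p 0) 1, p 1]

/-- The unit normal field `ξ = (y'/F) E₁ - (x'/F) E₂` of the Hopf cylinder, where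
`E₁ = F ∂ₓ - (l y / 2) ∂_z` and `E₂ = F ∂_y + (l x / 2) ∂_z`. -/
def hopfNormal (m l : ℝ) (γ : ℝ → (Fin 2 → ℝ)) (p : Fin 2 → ℝ) : Fin 3 → ℝ :=
  let x := γ (p 0) 0
  let y := γ (p 0) 1
  let F := conf m x y
  let E₁ : Fin 3 → ℝ := ![F, 0, -(l * y / 2)]
  let E₂ : Fin 3 → ℝ := ![0, F, l * x / 2]
  (vel γ (p 0) 1 / F) • E₁ - (vel γ (p 0) 0 / F) • E₂

/-- The signed geodesic curvature `κ` of the unit speed curve `γ` in the base surface, with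
respect to the unit normal `y' ∂ₓ - x' ∂_y` (the projection of the normal `ξ` of the Hopf
cylinder). -/
def geodCurv (m : ℝ) (γ : ℝ → (Fin 2 → ℝ)) (s : ℝ) : ℝ :=
  ip (baseMetric m) (γ s) (covAccel (baseMetric m) γ s) ![vel γ s 1, -vel γ s 0]

/-! ### The explicit solutions -/

/-- The explicit curvature functions `k(s, m, K)`. -/
def IsCurvatureSolution (m K : ℝ) (I : Set ℝ) (k : ℝ → ℝ) : Prop :=
  (4 * m + K < 0 ∧ ∃ C D ε : ℝ, (ε = 1 ∨ ε = -1) ∧ 0 ≤ 4 * C * D + 1 / (4 * m + K) ∧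
    ∀ s ∈ I, k s = 1 / (C * Real.exp (2 * √(-(4 * m + K)) * s)
      + D * Real.exp (-(2 * √(-(4 * m + K)) * s))
      + ε * √(4 * C * D + 1 / (4 * m + K)))) ∨
  (4 * m + K = 0 ∧ ∃ C D : ℝ,
    ∀ s ∈ I, k s = 4 * C / (16 + C ^ 2 * (s + D) ^ 2)) ∨
  (0 < 4 * m + K ∧ ∃ C D : ℝ,
    ∀ s ∈ I, k s = 1 / (C * Real.cos (2 * √(4 * m + K) * s)
      + D * Real.sin (2 * √(4 * m + K) * s)
      + √(1 / (4 * m + K) + (C ^ 2 + D ^ 2))))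

/-- The explicit functions `ψ(z, K)`. -/
def IsFibreSolution (K : ℝ) (J : Set ℝ) (ψ : ℝ → ℝ) : Prop :=
  (K < 0 ∧ ∃ a b : ℝ, ∀ z ∈ J, ψ z = a * Real.sin (√(-K) * z) + b * Real.cos (√(-K) * z)) ∨
  (K = 0 ∧ ∃ a b : ℝ, ∀ z ∈ J, ψ z = a * z + b) ∨
  (0 < K ∧ ∃ a b : ℝ, ∀ z ∈ J, ψ z = a * Real.exp (√K * z) + b * Real.exp (-(√K * z)))

end HopfBCV

end

/-! Along the Hopf cylinder the frame consisting of the horizontal lift `X` of `γ'`, the vertical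
field `V` and the lift `ξ` of the normal of `γ` has constant connection coefficients up to `κ`, and
the tension field of the conformal immersion is `f κ ξ`. Writing `u = f κ`, the `X`-, `V`- and
`ξ`-components of the biharmonic equation are scalar equations for `u`, the second one being
`l X(u) = 0`. If `l ≠ 0`, then `X(u) = 0`, the first equation becomes `u_z = -(κ' / l) u`, and
equality of mixed derivatives makes `κ'` and then `f` constant.

If `l = 0`, then `2 κ u_s + κ' u = 0`, so `u² κ` is constant along the horizontal lines. Hence `κ`
has no zeros and `f = ψ(z) w(s)³` with `|κ| = w⁻²`, and the third equation separates into
`ψ'' = K ψ` and the Ermakov equation `w'' = w⁻³ - (4 m + K) w`. By conservation of the energy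
`w'² + w⁻² + (4 m + K) w²`, the square `w²` solves a linear equation with constant coefficients. -/

noncomputable section

namespace HopfBCV

section PartialDerivatives

variable {d : ℕ} {i : Fin d} {u v : (Fin d → ℝ) → ℝ} {p : Fin d → ℝ}

theorem pd_congr (h : u =ᶠ[nhds p] v) : pd i u p = pd i v p := by
  rw [pd, pd, h.fderiv_eq]

theorem pd_const (c : ℝ) : pd i (fun _ => c) p = 0 := by
  simp [pd]

theorem pd_coord (j : Fin d) : pd i (fun q => q j) p = if i = j then 1 else 0 := by
  rw [pd, (hasFDerivAt_apply j p).fderiv, ContinuousLinearMap.proj_apply, Pi.single_apply]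
  simp only [eq_comm]

theorem pd_add (hu : DifferentiableAt ℝ u p) (hv : DifferentiableAt ℝ v p) :
    pd i (fun q => u q + v q) p = pd i u p + pd i v p := by
  simp [pd, fderiv_fun_add hu hv]

theorem pd_sub (hu : DifferentiableAt ℝ u p) (hv : DifferentiableAt ℝ v p) :
    pd i (fun q => u q - v q) p = pd i u p - pd i v p := by
  simp [pd, fderiv_fun_sub hu hv]

theorem pd_neg : pd i (fun q => -u q) p = -pd i u p := by
  simp [pd, fderiv_fun_neg]

theorem pd_mul (hu : DifferentiableAt ℝ u p) (hv : DifferentiableAt ℝ v p) :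
    pd i (fun q => u q * v q) p = u p * pd i v p + pd i u p * v p := by
  simp [pd, fderiv_fun_mul hu hv, mul_comm]

theorem pd_comp {g : ℝ → ℝ} {g' : ℝ} (hg : HasDerivAt g g' (u p)) (hu : DifferentiableAt ℝ u p) :
    pd i (fun q => g (u q)) p = g' * pd i u p := by
  have h : HasFDerivAt (fun q => g (u q)) (g' • fderiv ℝ u p) p :=
    hg.comp_hasFDerivAt p hu.hasFDerivAt
  rw [pd, h.fderiv]
  rfl

theorem pd_comp_coord {g : ℝ → ℝ} {g' : ℝ} {j : Fin d} (hg : HasDerivAt g g' (p j)) :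
    pd i (fun q => g (q j)) p = if i = j then g' else 0 := by
  rw [pd_comp hg (differentiableAt_apply j p), pd_coord, mul_ite, mul_one, mul_zero]

theorem pd_sq (hu : DifferentiableAt ℝ u p) :
    pd i (fun q => u q ^ 2) p = 2 * u p * pd i u p := by
  simpa using pd_comp (i := i) (hasDerivAt_pow 2 (u p)) hu

theorem pd_inv (hu : DifferentiableAt ℝ u p) (h : u p ≠ 0) :
    pd i (fun q => (u q)⁻¹) p = -pd i u p / u p ^ 2 := by
  rw [pd_comp (hasDerivAt_inv h) hu]
  ring

theorem pd_div (hu : DifferentiableAt ℝ u p) (hv : DifferentiableAt ℝ v p) (h : v p ≠ 0) :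
    pd i (fun q => u q / v q) p = (pd i u p * v p - u p * pd i v p) / v p ^ 2 := by
  simp only [div_eq_mul_inv (u _)]
  rw [pd_mul hu (hv.fun_inv h), pd_inv hv h]
  field_simp
  ring

theorem contDiffOn_pd {U : Set (Fin d → ℝ)} (hU : IsOpen U) (hu : ContDiffOn ℝ ∞ u U)
    (i : Fin d) : ContDiffOn ℝ ∞ (pd i u) U :=
  (hu.fderiv_of_isOpen hU (by simp)).clm_apply contDiffOn_const

theorem pd_comm (hu : ContDiffAt ℝ 2 u p) (i j : Fin d) :
    pd i (pd j u) p = pd j (pd i u) p := by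
  have hd : DifferentiableAt ℝ (fderiv ℝ u) p :=
    (hu.fderiv_right (m := 1) (by norm_num)).differentiableAt one_ne_zero
  have second_pd : ∀ i j : Fin d, pd i (pd j u) p =
      fderiv ℝ (fderiv ℝ u) p (Pi.single i 1) (Pi.single j 1) := fun i j => by
    have h : HasFDerivAt (pd j u) _ p :=
      hd.hasFDerivAt.clm_apply (hasFDerivAt_const (Pi.single j (1 : ℝ) : Fin d → ℝ) p)
    rw [pd, h.fderiv]
    simp
  rw [second_pd, second_pd, hu.isSymmSndFDerivAt (by simp)]

theorem hasDerivAt_comp_update {t : ℝ} (hu : DifferentiableAt ℝ u (Function.update p i t)) :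
    HasDerivAt (fun r => u (Function.update p i r)) (pd i u (Function.update p i t)) t :=
  hu.hasFDerivAt.comp_hasDerivAt t (hasDerivAt_update p i t)

theorem exists_const_of_pd_eq_zero {U : Set (Fin d → ℝ)} (hU : IsOpen U) (hU' : IsPreconnected U)
    (hu : DifferentiableOn ℝ u U) (h : ∀ p ∈ U, ∀ i, pd i u p = 0) : ∃ c, ∀ p ∈ U, u p = c :=
  hU.exists_is_const_of_fderiv_eq_zero hU' hu fun p hp =>
    ContinuousLinearMap.coe_injective ((Pi.basisFun ℝ (Fin d)).ext fun i => by
      simpa [pd] using h p hp i)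

end PartialDerivatives

/-! ### The geometry of BCV spaces -/

@[fun_prop]
theorem differentiableAt_conf {E : Type*} [NormedAddCommGroup E] [NormedSpace ℝ E] (m : ℝ)
    {u v : E → ℝ} {p : E} (hu : DifferentiableAt ℝ u p) (hv : DifferentiableAt ℝ v p) :
    DifferentiableAt ℝ (fun q => conf m (u q) (v q)) p := by
  unfold conf; fun_prop

theorem pd_conf {d : ℕ} (m : ℝ) (a b i : Fin d) (p : Fin d → ℝ) :
    pd i (fun q => conf m (q a) (q b)) p =
      2 * m * (p a * (if i = a then 1 else 0) + p b * (if i = b then 1 else 0)) := by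
  unfold conf
  simp (disch := fun_prop) only [pd_add, pd_mul, pd_sq, pd_const, pd_coord]
  ring

theorem bcvMetric_eq (m l : ℝ) (p : Fin 3 → ℝ) :
    bcvMetric m l p =
      !![(1 / conf m (p 0) (p 1)) ^ 2 + (l / 2 * p 1 / conf m (p 0) (p 1)) ^ 2,
          -(l / 2 * p 1 / conf m (p 0) (p 1) * (l / 2 * p 0 / conf m (p 0) (p 1))),
          l / 2 * p 1 / conf m (p 0) (p 1);
        -(l / 2 * p 1 / conf m (p 0) (p 1) * (l / 2 * p 0 / conf m (p 0) (p 1))),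
          (1 / conf m (p 0) (p 1)) ^ 2 + (l / 2 * p 0 / conf m (p 0) (p 1)) ^ 2,
          -(l / 2 * p 0 / conf m (p 0) (p 1));
        l / 2 * p 1 / conf m (p 0) (p 1), -(l / 2 * p 0 / conf m (p 0) (p 1)), 1] := by
  ext i j
  fin_cases i <;> fin_cases j <;>
    simp [bcvMetric, bcvCoframe, Matrix.mul_apply, Fin.sum_univ_three] <;> ring

theorem bcvMetric_inv (m l : ℝ) (p : Fin 3 → ℝ) (hF : conf m (p 0) (p 1) ≠ 0) :
    (bcvMetric m l p)⁻¹ =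
      !![conf m (p 0) (p 1) ^ 2, 0, -(l / 2 * p 1 * conf m (p 0) (p 1));
        0, conf m (p 0) (p 1) ^ 2, l / 2 * p 0 * conf m (p 0) (p 1);
        -(l / 2 * p 1 * conf m (p 0) (p 1)), l / 2 * p 0 * conf m (p 0) (p 1),
          1 + (l / 2) ^ 2 * (p 0 ^ 2 + p 1 ^ 2)] := by
  apply Matrix.inv_eq_right_inv
  rw [bcvMetric_eq]
  ext i j
  fin_cases i <;> fin_cases j <;>
    simp [Matrix.mul_apply, Fin.sum_univ_three] <;> field_simp <;> ring

/-- The partial derivatives of the metric coefficients of the BCV space. -/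
def bcvMetricDeriv (m l : ℝ) (p : Fin 3 → ℝ) : Fin 3 → Fin 3 → Fin 3 → ℝ :=
  let x := p 0
  let y := p 1
  let F := conf m x y
  ![![![-4 * m * x - m * x * l ^ 2 * y ^ 2, -(l ^ 2 / 4 * y * (F - 4 * m * x ^ 2)),
        -(m * l * x * y * F)],
      ![-(l ^ 2 / 4 * y * (F - 4 * m * x ^ 2)),
        -4 * m * x + l ^ 2 / 2 * x * (F - 2 * m * x ^ 2), -(l / 2 * (F - 2 * m * x ^ 2) * F)],
      ![-(m * l * x * y * F), -(l / 2 * (F - 2 * m * x ^ 2) * F), 0]],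
    ![![-4 * m * y + l ^ 2 / 2 * y * (F - 2 * m * y ^ 2),
        -(l ^ 2 / 4 * x * (F - 4 * m * y ^ 2)), l / 2 * (F - 2 * m * y ^ 2) * F],
      ![-(l ^ 2 / 4 * x * (F - 4 * m * y ^ 2)), -4 * m * y - m * y * l ^ 2 * x ^ 2,
        m * l * x * y * F],
      ![l / 2 * (F - 2 * m * y ^ 2) * F, m * l * x * y * F, 0]],
    ![![0, 0, 0], ![0, 0, 0], ![0, 0, 0]]]

theorem pd_bcvMetric (m l : ℝ) (p : Fin 3 → ℝ) (hF : conf m (p 0) (p 1) ≠ 0)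
    (i j k : Fin 3) :
    pd i (fun q => bcvMetric m l q j k) p =
      bcvMetricDeriv m l p i j k / conf m (p 0) (p 1) ^ 3 := by
  simp only [bcvMetric_eq]
  fin_cases i <;> fin_cases j <;> fin_cases k <;>
    simp only [Matrix.of_apply, Matrix.cons_val', Matrix.cons_val, Matrix.cons_val_zero,
      Matrix.cons_val_one, Fin.zero_eta, Fin.mk_one, Fin.reduceFinMk, Matrix.cons_val_fin_one] <;>
    simp (disch := first | assumption | fun_prop (disch := assumption)) only
      [pd_add, pd_mul, pd_sq, pd_const, pd_coord, pd_div, pd_neg, pd_conf] <;>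
    simp [bcvMetricDeriv] <;> field_simp <;> ring

/-- The Christoffel symbols of the BCV space. -/
def bcvChristoffel (m l : ℝ) (p : Fin 3 → ℝ) : Fin 3 → Fin 3 → Fin 3 → ℝ :=
  let x := p 0
  let y := p 1
  let F := conf m x y
  ![![![-(2 * m * x) / F, (l ^ 2 / 4 - 2 * m) * y / F, 0],
      ![(l ^ 2 / 4 - 2 * m) * y / F, (2 * m - l ^ 2 / 2) * x / F, l / 2],
      ![0, l / 2, 0]],
    ![![(2 * m - l ^ 2 / 2) * y / F, (l ^ 2 / 4 - 2 * m) * x / F, -(l / 2)],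
      ![(l ^ 2 / 4 - 2 * m) * x / F, -(2 * m * y) / F, 0],
      ![-(l / 2), 0, 0]],
    ![![l * (m - l ^ 2 / 4) * x * y / F ^ 2, l / 2 * (m - l ^ 2 / 4) * (y ^ 2 - x ^ 2) / F ^ 2,
        -(l ^ 2 / 4 * x) / F],
      ![l / 2 * (m - l ^ 2 / 4) * (y ^ 2 - x ^ 2) / F ^ 2, -(l * (m - l ^ 2 / 4) * x * y) / F ^ 2,
        -(l ^ 2 / 4 * y) / F],
      ![-(l ^ 2 / 4 * x) / F, -(l ^ 2 / 4 * y) / F, 0]]]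

theorem christoffel_bcvMetric (m l : ℝ) (p : Fin 3 → ℝ) (hF : conf m (p 0) (p 1) ≠ 0)
    (k i j : Fin 3) :
    christoffel (bcvMetric m l) k i j p = bcvChristoffel m l p k i j := by
  simp only [christoffel, pd_bcvMetric m l p hF, bcvMetric_inv m l p hF, Fin.sum_univ_three]
  fin_cases k <;> fin_cases i <;> fin_cases j <;>
    simp [bcvMetricDeriv, bcvChristoffel] <;> field_simp <;> (try simp only [conf]) <;> ring

theorem eventually_conf_ne_zero {d : ℕ} {m : ℝ} {a b : Fin d} {p : Fin d → ℝ}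
    (hF : conf m (p a) (p b) ≠ 0) : ∀ᶠ q in nhds p, conf m (q a) (q b) ≠ 0 :=
  (show DifferentiableAt ℝ (fun q : Fin d → ℝ => conf m (q a) (q b)) p by
    fun_prop).continuousAt.eventually_ne hF

theorem curvature_antisymm {n : ℕ} (h : (Fin n → ℝ) → Matrix (Fin n) (Fin n) ℝ)
    (a c i j : Fin n) (p : Fin n → ℝ) : curvature h a c j i p = -curvature h a c i j p := by
  simp only [curvature, neg_add, ← Finset.sum_neg_distrib, neg_sub]

/-- The one-form `dz + (l/2) (y dx - x dy) / F`. -/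
def contactForm (m l : ℝ) (p : Fin 3 → ℝ) : Fin 3 → ℝ :=
  ![l / 2 * p 1 / conf m (p 0) (p 1), -(l / 2 * p 0 / conf m (p 0) (p 1)), 1]

/-- The curvature tensor of the BCV space in terms of the metric and the contact form. -/
def bcvCurvature (m l : ℝ) (p : Fin 3 → ℝ) (a c i j : Fin 3) : ℝ :=
  let h := bcvMetric m l p
  let η := contactForm m l p
  let δ : Fin 3 → Fin 3 → ℝ := fun r s => if r = s then 1 else 0
  (4 * m - 3 * l ^ 2 / 4) * (h j c * δ a i - h i c * δ a j)
    - (4 * m - l ^ 2) * (η j * η c * δ a i - η i * η c * δ a j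
      + (h j c * η i - h i c * η j) * δ a 2)

theorem bcvCurvature_antisymm (m l : ℝ) (p : Fin 3 → ℝ) (a c i j : Fin 3) :
    bcvCurvature m l p a c j i = -bcvCurvature m l p a c i j := by
  simp only [bcvCurvature]; ring

theorem pd_christoffel_bcvMetric (m l : ℝ) (p : Fin 3 → ℝ) (hF : conf m (p 0) (p 1) ≠ 0)
    (i k a b : Fin 3) :
    pd i (christoffel (bcvMetric m l) k a b) p = pd i (fun q => bcvChristoffel m l q k a b) p :=
  pd_congr ((eventually_conf_ne_zero hF).mono fun q hq => christoffel_bcvMetric m l q hq k a b)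

set_option maxHeartbeats 800000 in
-- The 27 components are computed separately from the table of Christoffel symbols.
theorem curvature_bcvMetric_of_lt (m l : ℝ) (p : Fin 3 → ℝ) (hF : conf m (p 0) (p 1) ≠ 0)
    (a c : Fin 3) {i j : Fin 3} (hij : i < j) :
    curvature (bcvMetric m l) a c i j p = bcvCurvature m l p a c i j := by
  have hF' := pow_ne_zero 2 hF
  simp only [curvature, pd_christoffel_bcvMetric m l p hF, christoffel_bcvMetric m l p hF,
    Fin.sum_univ_three]
  fin_cases i <;> fin_cases j <;> first
    | exact absurd hij (by decide)
    | fin_cases a <;> fin_cases c <;>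
      simp only [bcvChristoffel, Matrix.cons_val', Matrix.cons_val, Matrix.cons_val_zero,
        Matrix.cons_val_one, Fin.zero_eta, Fin.mk_one, Fin.reduceFinMk,
        Matrix.cons_val_fin_one] <;>
      (try simp (disch := first | assumption | fun_prop (disch := assumption)) only
        [pd_sub, pd_mul, pd_sq, pd_const, pd_coord, pd_div, pd_neg, pd_conf]) <;>
      simp [bcvCurvature, bcvMetric_eq, contactForm] <;> field_simp <;>
      (try simp only [conf]) <;> ring

theorem curvature_bcvMetric (m l : ℝ) (p : Fin 3 → ℝ) (hF : conf m (p 0) (p 1) ≠ 0)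
    (a c i j : Fin 3) : curvature (bcvMetric m l) a c i j p = bcvCurvature m l p a c i j := by
  rcases lt_trichotomy i j with hij | rfl | hji
  · exact curvature_bcvMetric_of_lt m l p hF a c hij
  · linarith [curvature_antisymm (bcvMetric m l) a c i i p, bcvCurvature_antisymm m l p a c i i]
  · rw [curvature_antisymm, bcvCurvature_antisymm, curvature_bcvMetric_of_lt m l p hF a c hji]

theorem baseMetric_inv (m : ℝ) (p : Fin 2 → ℝ) (hF : conf m (p 0) (p 1) ≠ 0) :
    (baseMetric m p)⁻¹ = !![conf m (p 0) (p 1) ^ 2, 0; 0, conf m (p 0) (p 1) ^ 2] := by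
  apply Matrix.inv_eq_right_inv
  ext i j
  fin_cases i <;> fin_cases j <;>
    simp [baseMetric, Matrix.mul_apply, Fin.sum_univ_two] <;> field_simp

theorem pd_inv_conf_sq (m : ℝ) (p : Fin 2 → ℝ) (hF : conf m (p 0) (p 1) ≠ 0) (i : Fin 2) :
    pd i (fun q => 1 / conf m (q 0) (q 1) ^ 2) p = -4 * m * p i / conf m (p 0) (p 1) ^ 3 := by
  have hF' := pow_ne_zero 2 hF
  simp (disch := first | assumption | fun_prop (disch := assumption)) only
    [pd_sq, pd_const, pd_div, pd_conf]
  fin_cases i <;> simp <;> field_simp <;> ring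

theorem pd_baseMetric (m : ℝ) (p : Fin 2 → ℝ) (hF : conf m (p 0) (p 1) ≠ 0) (i j k : Fin 2) :
    pd i (fun q => baseMetric m q j k) p =
      if j = k then -4 * m * p i / conf m (p 0) (p 1) ^ 3 else 0 := by
  fin_cases j <;> fin_cases k
  exacts [pd_inv_conf_sq m p hF i, pd_const 0, pd_const 0, pd_inv_conf_sq m p hF i]

theorem christoffel_baseMetric (m : ℝ) (p : Fin 2 → ℝ) (hF : conf m (p 0) (p 1) ≠ 0)
    (k i j : Fin 2) :
    christoffel (baseMetric m) k i j p = -(2 * m) / conf m (p 0) (p 1) *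
      ((if j = k then p i else 0) + (if i = k then p j else 0) - if i = j then p k else 0) := by
  simp only [christoffel, pd_baseMetric m p hF, baseMetric_inv m p hF, Fin.sum_univ_two]
  fin_cases k <;> fin_cases i <;> fin_cases j <;> simp <;> field_simp <;> ring

/-! ### The adapted frame of a Hopf cylinder -/

/-- A smooth unit speed curve `γ`, parametrized by the open set `I`, in the base surface. -/
structure IsUnitSpeedCurve (m : ℝ) (γ : ℝ → (Fin 2 → ℝ)) (I : Set ℝ) : Prop where
  isOpen : IsOpen I
  contDiffOn : ContDiffOn ℝ ∞ γ I
  conf_ne_zero : ∀ s ∈ I, conf m (γ s 0) (γ s 1) ≠ 0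
  ip_vel : ∀ s ∈ I, ip (baseMetric m) (γ s) (vel γ s) (vel γ s) = 1

namespace IsUnitSpeedCurve

variable {m : ℝ} {γ : ℝ → (Fin 2 → ℝ)} {I : Set ℝ} {s : ℝ}

theorem contDiffOn_apply (h : IsUnitSpeedCurve m γ I) (i : Fin 2) :
    ContDiffOn ℝ ∞ (fun t => γ t i) I :=
  contDiffOn_pi.1 h.contDiffOn i

theorem contDiffOn_vel (h : IsUnitSpeedCurve m γ I) (i : Fin 2) :
    ContDiffOn ℝ ∞ (fun t => vel γ t i) I :=
  (h.contDiffOn_apply i).deriv_of_isOpen h.isOpen (by simp)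

theorem contDiffOn_conf (h : IsUnitSpeedCurve m γ I) :
    ContDiffOn ℝ ∞ (fun t => conf m (γ t 0) (γ t 1)) I :=
  contDiffOn_const.add
    (contDiffOn_const.mul (((h.contDiffOn_apply 0).pow 2).add ((h.contDiffOn_apply 1).pow 2)))

theorem hasDerivAt_apply (h : IsUnitSpeedCurve m γ I) (hs : s ∈ I) (i : Fin 2) :
    HasDerivAt (fun t => γ t i) (vel γ s i) s :=
  (((h.contDiffOn_apply i).contDiffAt (h.isOpen.mem_nhds hs)).differentiableAt
    (by simp)).hasDerivAt

theorem hasDerivAt_vel (h : IsUnitSpeedCurve m γ I) (hs : s ∈ I) (i : Fin 2) :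
    HasDerivAt (fun t => vel γ t i) (deriv (fun t => vel γ t i) s) s :=
  (((h.contDiffOn_vel i).contDiffAt (h.isOpen.mem_nhds hs)).differentiableAt
    (by simp)).hasDerivAt

theorem hasDerivAt_conf (h : IsUnitSpeedCurve m γ I) (hs : s ∈ I) :
    HasDerivAt (fun t => conf m (γ t 0) (γ t 1))
      (2 * m * (γ s 0 * vel γ s 0 + γ s 1 * vel γ s 1)) s := by
  unfold conf
  refine ((((h.hasDerivAt_apply hs 0).pow 2).add
    ((h.hasDerivAt_apply hs 1).pow 2)).const_mul m).const_add 1 |>.congr_deriv ?_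
  push_cast; ring

theorem vel_sq_add_vel_sq (h : IsUnitSpeedCurve m γ I) (hs : s ∈ I) :
    vel γ s 0 ^ 2 + vel γ s 1 ^ 2 = conf m (γ s 0) (γ s 1) ^ 2 := by
  have hF := h.conf_ne_zero s hs
  have hunit : vel γ s 0 ^ 2 / conf m (γ s 0) (γ s 1) ^ 2
      + vel γ s 1 ^ 2 / conf m (γ s 0) (γ s 1) ^ 2 = 1 := by
    rw [← h.ip_vel s hs]
    simp [ip, baseMetric, Fin.sum_univ_two]
    ring
  field_simp at hunit
  exact hunit

theorem vel_mul_deriv_vel (h : IsUnitSpeedCurve m γ I) (hs : s ∈ I) :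
    vel γ s 0 * deriv (fun t => vel γ t 0) s + vel γ s 1 * deriv (fun t => vel γ t 1) s =
      2 * m * conf m (γ s 0) (γ s 1) * (γ s 0 * vel γ s 0 + γ s 1 * vel γ s 1) := by
  have hspeed := ((h.hasDerivAt_vel hs 0).pow 2).add ((h.hasDerivAt_vel hs 1).pow 2)
  have hconf := ((h.hasDerivAt_conf hs).pow 2).congr_of_eventuallyEq
    (Filter.eventuallyEq_of_mem (h.isOpen.mem_nhds hs) fun t ht => h.vel_sq_add_vel_sq ht)
  have hderiv := hspeed.unique hconf
  norm_num at hderiv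
  linarith

theorem geodCurv_eq (h : IsUnitSpeedCurve m γ I) (hs : s ∈ I) :
    geodCurv m γ s =
      (deriv (fun t => vel γ t 0) s * vel γ s 1 - deriv (fun t => vel γ t 1) s * vel γ s 0)
        / conf m (γ s 0) (γ s 1) ^ 2
      - 2 * m * (γ s 1 * vel γ s 0 - γ s 0 * vel γ s 1) / conf m (γ s 0) (γ s 1) := by
  have hF := h.conf_ne_zero s hs
  simp only [geodCurv, ip, baseMetric, covAccel, christoffel_baseMetric m _ hF, Fin.sum_univ_two]
  simp
  field_simp
  linear_combination (-2 * m * (γ s 1 * vel γ s 0 - γ s 0 * vel γ s 1)) * h.vel_sq_add_vel_sq hs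

theorem deriv_vel_zero (h : IsUnitSpeedCurve m γ I) (hs : s ∈ I) :
    deriv (fun t => vel γ t 0) s = geodCurv m γ s * vel γ s 1
      + 2 * m / conf m (γ s 0) (γ s 1) *
        (vel γ s 0 * (γ s 0 * vel γ s 0 + γ s 1 * vel γ s 1)
          + vel γ s 1 * (γ s 1 * vel γ s 0 - γ s 0 * vel γ s 1)) := by
  have hF := h.conf_ne_zero s hs
  rw [h.geodCurv_eq hs]
  field_simp
  linear_combination vel γ s 0 * h.vel_mul_deriv_vel hs
    - deriv (fun t => vel γ t 0) s * h.vel_sq_add_vel_sq hs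

theorem deriv_vel_one (h : IsUnitSpeedCurve m γ I) (hs : s ∈ I) :
    deriv (fun t => vel γ t 1) s = -(geodCurv m γ s * vel γ s 0)
      + 2 * m / conf m (γ s 0) (γ s 1) *
        (vel γ s 1 * (γ s 0 * vel γ s 0 + γ s 1 * vel γ s 1)
          - vel γ s 0 * (γ s 1 * vel γ s 0 - γ s 0 * vel γ s 1)) := by
  have hF := h.conf_ne_zero s hs
  rw [h.geodCurv_eq hs]
  field_simp
  linear_combination vel γ s 1 * h.vel_mul_deriv_vel hs
    - deriv (fun t => vel γ t 1) s * h.vel_sq_add_vel_sq hs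

theorem contDiffOn_geodCurv (h : IsUnitSpeedCurve m γ I) : ContDiffOn ℝ ∞ (geodCurv m γ) I := by
  have hγ := h.contDiffOn_apply
  have hv := h.contDiffOn_vel
  have ha (i : Fin 2) : ContDiffOn ℝ ∞ (fun t => deriv (fun t => vel γ t i) t) I :=
    (hv i).deriv_of_isOpen h.isOpen (by simp)
  have hF := h.contDiffOn_conf
  refine ContDiffOn.congr ?_ fun t ht => h.geodCurv_eq ht
  exact ((((ha 0).mul (hv 1)).sub ((ha 1).mul (hv 0))).div (hF.pow 2)
    fun t ht => pow_ne_zero 2 (h.conf_ne_zero t ht)).sub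
    ((contDiffOn_const.mul (((hγ 1).mul (hv 0)).sub ((hγ 0).mul (hv 1)))).div hF h.conf_ne_zero)

end IsUnitSpeedCurve

section CovariantDerivative

variable {d n : ℕ} {h : (Fin n → ℝ) → Matrix (Fin n) (Fin n) ℝ} {φ : (Fin d → ℝ) → (Fin n → ℝ)}
  {i : Fin d} {V W : (Fin d → ℝ) → (Fin n → ℝ)} {p : Fin d → ℝ}

theorem covAlong_congr (hVW : V =ᶠ[nhds p] W) : covAlong h φ i V p = covAlong h φ i W p := by
  funext a
  simp only [covAlong, hVW.eq_of_nhds]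
  rw [pd_congr (u := fun q => V q a) (v := fun q => W q a) (hVW.fun_comp fun v => v a)]

theorem covAlong_add (hV : DifferentiableAt ℝ V p) (hW : DifferentiableAt ℝ W p) :
    covAlong h φ i (fun q => V q + W q) p = covAlong h φ i V p + covAlong h φ i W p := by
  funext a
  simp only [covAlong, Pi.add_apply,
    pd_add (differentiableAt_pi.1 hV a) (differentiableAt_pi.1 hW a), mul_add,
    Finset.sum_add_distrib]
  ring

theorem covAlong_smul {u : (Fin d → ℝ) → ℝ} (hu : DifferentiableAt ℝ u p)
    (hV : DifferentiableAt ℝ V p) :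
    covAlong h φ i (fun q => u q • V q) p = pd i u p • V p + u p • covAlong h φ i V p := by
  funext a
  simp only [covAlong, Pi.add_apply, Pi.smul_apply, smul_eq_mul,
    pd_mul hu (differentiableAt_pi.1 hV a), mul_add, Finset.mul_sum, mul_left_comm (u p)]
  ring

theorem covAlong_comp_coord {Y : ℝ → (Fin n → ℝ)} {Y' : Fin n → ℝ} {j : Fin d}
    (hY : HasDerivAt Y Y' (p j)) (a : Fin n) :
    covAlong h φ i (fun q => Y (q j)) p a = (if i = j then Y' a else 0)
      + ∑ b, ∑ c, christoffel h a b c (φ p) * dmap φ i p b * Y (p j) c := by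
  rw [covAlong, pd_comp_coord (g := fun t => Y t a) (hasDerivAt_pi.1 hY a)]

end CovariantDerivative

/-- The function `t` for which `dφ(∂ₛ) - t ∂_z` is horizontal, where `φ` is the Hopf cylinder
over `γ`. -/
def tilt (m l : ℝ) (γ : ℝ → (Fin 2 → ℝ)) (s : ℝ) : ℝ :=
  l / 2 * (γ s 1 * vel γ s 0 - γ s 0 * vel γ s 1) / conf m (γ s 0) (γ s 1)

theorem tilt_zero (m : ℝ) (γ : ℝ → (Fin 2 → ℝ)) : tilt m 0 γ = 0 := by
  funext s
  simp [tilt]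

/-- The analogue of `tilt` for the normal `y' ∂ₓ - x' ∂_y` in place of the velocity: subtracting
it times `∂_z` makes the normal horizontal. -/
def normalTilt (m l : ℝ) (γ : ℝ → (Fin 2 → ℝ)) (s : ℝ) : ℝ :=
  l / 2 * (γ s 0 * vel γ s 0 + γ s 1 * vel γ s 1) / conf m (γ s 0) (γ s 1)

/-- The horizontal lift `X` of the velocity of `γ`. Like all fields of the frame it is invariant
along the fibres, so that it is given as a function of `s` only. -/
def horizontalLift (m l : ℝ) (γ : ℝ → (Fin 2 → ℝ)) (s : ℝ) : Fin 3 → ℝ :=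
  ![vel γ s 0, vel γ s 1, -tilt m l γ s]

/-- The unit vector `V = ∂_z` tangent to the fibres. -/
def vertical : Fin 3 → ℝ := ![0, 0, 1]

/-- The horizontal lift `ξ` of the normal `y' ∂ₓ - x' ∂_y` of `γ`. -/
def normalLift (m l : ℝ) (γ : ℝ → (Fin 2 → ℝ)) (s : ℝ) : Fin 3 → ℝ :=
  ![vel γ s 1, -vel γ s 0, -normalTilt m l γ s]

/-- The vector `a X + b V + c ξ` with components `a`, `b`, `c` in the adapted frame. -/
def frameVec (m l : ℝ) (γ : ℝ → (Fin 2 → ℝ)) (s a b c : ℝ) : Fin 3 → ℝ :=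
  a • horizontalLift m l γ s + b • vertical + c • normalLift m l γ s

theorem hopfNormal_eq (m l : ℝ) (γ : ℝ → (Fin 2 → ℝ)) (p : Fin 2 → ℝ)
    (hF : conf m (γ (p 0) 0) (γ (p 0) 1) ≠ 0) :
    hopfNormal m l γ p = normalLift m l γ (p 0) := by
  funext a
  fin_cases a <;> simp [hopfNormal, normalLift, normalTilt] <;> field_simp
  ring

namespace IsUnitSpeedCurve

variable {m : ℝ} {γ : ℝ → (Fin 2 → ℝ)} {I : Set ℝ} {s : ℝ}

theorem hasDerivAt_tilt (h : IsUnitSpeedCurve m γ I) (l : ℝ) (hs : s ∈ I) :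
    HasDerivAt (tilt m l γ) (geodCurv m γ s * normalTilt m l γ s
      + l * m * (γ s 0 * vel γ s 0 + γ s 1 * vel γ s 1)
        * (γ s 1 * vel γ s 0 - γ s 0 * vel γ s 1) / conf m (γ s 0) (γ s 1) ^ 2) s := by
  have hF := h.conf_ne_zero s hs
  have hderiv := ((((h.hasDerivAt_apply hs 1).mul (h.hasDerivAt_vel hs 0)).sub
    ((h.hasDerivAt_apply hs 0).mul (h.hasDerivAt_vel hs 1))).const_mul (l / 2)).div
    (h.hasDerivAt_conf hs) hF
  refine hderiv.congr_deriv ?_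
  simp only [normalTilt, Pi.mul_apply, Pi.sub_apply, h.deriv_vel_zero hs, h.deriv_vel_one hs]
  field_simp
  ring

theorem hasDerivAt_normalTilt (h : IsUnitSpeedCurve m γ I) (l : ℝ) (hs : s ∈ I) :
    HasDerivAt (normalTilt m l γ) (l / 2 * conf m (γ s 0) (γ s 1)
      - geodCurv m γ s * tilt m l γ s
      - l * m * (γ s 1 * vel γ s 0 - γ s 0 * vel γ s 1) ^ 2 / conf m (γ s 0) (γ s 1) ^ 2) s := by
  have hF := h.conf_ne_zero s hs
  have hderiv := ((((h.hasDerivAt_apply hs 0).mul (h.hasDerivAt_vel hs 0)).add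
    ((h.hasDerivAt_apply hs 1).mul (h.hasDerivAt_vel hs 1))).const_mul (l / 2)).div
    (h.hasDerivAt_conf hs) hF
  refine hderiv.congr_deriv ?_
  simp only [tilt, Pi.mul_apply, Pi.add_apply, h.deriv_vel_zero hs, h.deriv_vel_one hs]
  field_simp
  linear_combination l * conf m (γ s 0) (γ s 1) * h.vel_sq_add_vel_sq hs

theorem hasDerivAt_horizontalLift (h : IsUnitSpeedCurve m γ I) (l : ℝ) (hs : s ∈ I) :
    HasDerivAt (horizontalLift m l γ) ![deriv (fun t => vel γ t 0) s,
      deriv (fun t => vel γ t 1) s, -deriv (tilt m l γ) s] s := by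
  rw [hasDerivAt_pi]
  intro a
  fin_cases a
  exacts [h.hasDerivAt_vel hs 0, h.hasDerivAt_vel hs 1,
    (h.hasDerivAt_tilt l hs).differentiableAt.hasDerivAt.neg]

theorem hasDerivAt_normalLift (h : IsUnitSpeedCurve m γ I) (l : ℝ) (hs : s ∈ I) :
    HasDerivAt (normalLift m l γ) ![deriv (fun t => vel γ t 1) s,
      -deriv (fun t => vel γ t 0) s, -deriv (normalTilt m l γ) s] s := by
  rw [hasDerivAt_pi]
  intro a
  fin_cases a
  exacts [h.hasDerivAt_vel hs 1, (h.hasDerivAt_vel hs 0).neg,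
    (h.hasDerivAt_normalTilt l hs).differentiableAt.hasDerivAt.neg]

theorem ip_frameVec (h : IsUnitSpeedCurve m γ I) (l : ℝ) (hs : s ∈ I) {P : Fin 3 → ℝ}
    (h0 : P 0 = γ s 0) (h1 : P 1 = γ s 1) (a b c a' b' c' : ℝ) :
    ip (bcvMetric m l) P (frameVec m l γ s a b c) (frameVec m l γ s a' b' c') =
      a * a' + b * b' + c * c' := by
  have hF := h.conf_ne_zero s hs
  simp only [ip, bcvMetric_eq, Fin.sum_univ_three, h0, h1]
  simp [frameVec, horizontalLift, vertical, normalLift, tilt, normalTilt]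
  field_simp
  linear_combination 4 * (a * a' + c * c') * h.vel_sq_add_vel_sq hs

theorem frameVec_eq_zero (h : IsUnitSpeedCurve m γ I) {l : ℝ} (hs : s ∈ I) {a b c : ℝ}
    (hzero : frameVec m l γ s a b c = 0) : a = 0 ∧ b = 0 ∧ c = 0 := by
  have hnorm := h.ip_frameVec l hs (P := ![γ s 0, γ s 1, 0]) rfl rfl a b c a b c
  simp only [hzero, ip, Pi.zero_apply, mul_zero, Finset.sum_const_zero] at hnorm
  refine ⟨?_, ?_, ?_⟩ <;> nlinarith

variable {p : Fin 2 → ℝ}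

theorem contactForm_frameVec (h : IsUnitSpeedCurve m γ I) (l : ℝ) (hp : p 0 ∈ I) (a b c : ℝ) :
    contactForm m l (hopfCylinder γ p) ⬝ᵥ frameVec m l γ (p 0) a b c = b := by
  have hF := h.conf_ne_zero _ hp
  simp [contactForm, dotProduct, Fin.sum_univ_three, frameVec, horizontalLift, vertical,
    normalLift, hopfCylinder, tilt, normalTilt]
  field_simp
  ring

theorem dmap_hopfCylinder_zero (h : IsUnitSpeedCurve m γ I) (l : ℝ) (hp : p 0 ∈ I) :
    dmap (hopfCylinder γ) 0 p = frameVec m l γ (p 0) 1 (tilt m l γ (p 0)) 0 := by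
  funext a
  fin_cases a
  · simpa [dmap, hopfCylinder, frameVec, horizontalLift, vertical] using
      pd_comp_coord (i := 0) (h.hasDerivAt_apply hp 0)
  · simpa [dmap, hopfCylinder, frameVec, horizontalLift, vertical] using
      pd_comp_coord (i := 0) (h.hasDerivAt_apply hp 1)
  · simpa [dmap, hopfCylinder, frameVec, horizontalLift, vertical] using
      pd_coord (p := p) (i := 0) 1

theorem dmap_hopfCylinder_one (h : IsUnitSpeedCurve m γ I) (l : ℝ) (hp : p 0 ∈ I) :
    dmap (hopfCylinder γ) 1 p = frameVec m l γ (p 0) 0 1 0 := by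
  funext a
  fin_cases a
  · simpa [dmap, hopfCylinder, frameVec, vertical] using
      pd_comp_coord (i := 1) (h.hasDerivAt_apply hp 0)
  · simpa [dmap, hopfCylinder, frameVec, vertical] using
      pd_comp_coord (i := 1) (h.hasDerivAt_apply hp 1)
  · simpa [dmap, hopfCylinder, frameVec, vertical] using pd_coord (p := p) (i := 1) 1

theorem christoffel_hopfCylinder (h : IsUnitSpeedCurve m γ I) (l : ℝ) (hp : p 0 ∈ I)
    (k i j : Fin 3) : christoffel (bcvMetric m l) k i j (hopfCylinder γ p) =
      bcvChristoffel m l (hopfCylinder γ p) k i j :=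
  christoffel_bcvMetric m l (hopfCylinder γ p) (h.conf_ne_zero _ hp) k i j

theorem covAlong_zero_horizontalLift (h : IsUnitSpeedCurve m γ I) (l : ℝ) (hp : p 0 ∈ I) :
    covAlong (bcvMetric m l) (hopfCylinder γ) 0 (fun q => horizontalLift m l γ (q 0)) p =
      (geodCurv m γ (p 0) + l / 2 * tilt m l γ (p 0)) • normalLift m l γ (p 0) := by
  have hF := h.conf_ne_zero _ hp
  funext a
  rw [covAlong_comp_coord (h.hasDerivAt_horizontalLift l hp)]
  simp only [h.christoffel_hopfCylinder l hp, h.dmap_hopfCylinder_zero l hp, Fin.sum_univ_three,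
    h.deriv_vel_zero hp, h.deriv_vel_one hp, (h.hasDerivAt_tilt l hp).deriv]
  fin_cases a <;> simp [frameVec, bcvChristoffel, hopfCylinder, horizontalLift, vertical,
    normalLift, tilt, normalTilt] <;> field_simp <;> ring

theorem covAlong_zero_vertical (h : IsUnitSpeedCurve m γ I) (l : ℝ) (hp : p 0 ∈ I) :
    covAlong (bcvMetric m l) (hopfCylinder γ) 0 (fun _ => vertical) p =
      (l / 2) • normalLift m l γ (p 0) := by
  have hF := h.conf_ne_zero _ hp
  funext a
  simp only [covAlong, h.christoffel_hopfCylinder l hp, h.dmap_hopfCylinder_zero l hp,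
    Fin.sum_univ_three, pd_const]
  fin_cases a <;> simp [frameVec, bcvChristoffel, hopfCylinder, horizontalLift, vertical,
    normalLift, normalTilt]
  field_simp
  ring

theorem covAlong_zero_normalLift (h : IsUnitSpeedCurve m γ I) (l : ℝ) (hp : p 0 ∈ I) :
    covAlong (bcvMetric m l) (hopfCylinder γ) 0 (fun q => normalLift m l γ (q 0)) p =
      -(geodCurv m γ (p 0) + l / 2 * tilt m l γ (p 0)) • horizontalLift m l γ (p 0)
        - (l / 2) • vertical := by
  have hF := h.conf_ne_zero _ hp
  have hsq := h.vel_sq_add_vel_sq hp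
  have hconf : m * (γ (p 0) 0 ^ 2 + γ (p 0) 1 ^ 2) = conf m (γ (p 0) 0) (γ (p 0) 1) - 1 := by
    simp [conf]
  funext a
  rw [covAlong_comp_coord (h.hasDerivAt_normalLift l hp)]
  simp only [h.christoffel_hopfCylinder l hp, h.dmap_hopfCylinder_zero l hp, Fin.sum_univ_three,
    h.deriv_vel_zero hp, h.deriv_vel_one hp, (h.hasDerivAt_normalTilt l hp).deriv]
  fin_cases a <;> simp [frameVec, bcvChristoffel, hopfCylinder, horizontalLift, vertical,
    normalLift, tilt, normalTilt] <;> field_simp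
  · ring
  · ring
  · linear_combination 16 * l * (vel γ (p 0) 0 ^ 2 + vel γ (p 0) 1 ^ 2) * hconf
      + 16 * l * (conf m (γ (p 0) 0) (γ (p 0) 1) - 1) * hsq

theorem covAlong_one_horizontalLift (h : IsUnitSpeedCurve m γ I) (l : ℝ) (hp : p 0 ∈ I) :
    covAlong (bcvMetric m l) (hopfCylinder γ) 1 (fun q => horizontalLift m l γ (q 0)) p =
      (l / 2) • normalLift m l γ (p 0) := by
  have hF := h.conf_ne_zero _ hp
  funext a
  rw [covAlong_comp_coord (h.hasDerivAt_horizontalLift l hp)]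
  simp only [h.christoffel_hopfCylinder l hp, h.dmap_hopfCylinder_one l hp, Fin.sum_univ_three]
  fin_cases a <;> simp [frameVec, bcvChristoffel, hopfCylinder, horizontalLift, vertical,
    normalLift, normalTilt]
  field_simp
  ring

theorem covAlong_one_vertical (h : IsUnitSpeedCurve m γ I) (l : ℝ) (hp : p 0 ∈ I) :
    covAlong (bcvMetric m l) (hopfCylinder γ) 1 (fun _ => vertical) p = 0 := by
  funext a
  simp only [covAlong, h.christoffel_hopfCylinder l hp, h.dmap_hopfCylinder_one l hp,
    Fin.sum_univ_three, pd_const]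
  fin_cases a <;> simp [frameVec, bcvChristoffel, vertical]

theorem covAlong_one_normalLift (h : IsUnitSpeedCurve m γ I) (l : ℝ) (hp : p 0 ∈ I) :
    covAlong (bcvMetric m l) (hopfCylinder γ) 1 (fun q => normalLift m l γ (q 0)) p =
      -(l / 2) • horizontalLift m l γ (p 0) := by
  have hF := h.conf_ne_zero _ hp
  funext a
  rw [covAlong_comp_coord (h.hasDerivAt_normalLift l hp)]
  simp only [h.christoffel_hopfCylinder l hp, h.dmap_hopfCylinder_one l hp, Fin.sum_univ_three]
  fin_cases a <;> simp [frameVec, bcvChristoffel, hopfCylinder, horizontalLift, vertical,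
    normalLift, tilt]
  field_simp
  ring

variable {α β υ : (Fin 2 → ℝ) → ℝ}

theorem covAlong_frameVec (h : IsUnitSpeedCurve m γ I) (l : ℝ) (hp : p 0 ∈ I)
    (hα : DifferentiableAt ℝ α p) (hβ : DifferentiableAt ℝ β p) (hυ : DifferentiableAt ℝ υ p)
    (i : Fin 2) :
    covAlong (bcvMetric m l) (hopfCylinder γ) i
        (fun q => frameVec m l γ (q 0) (α q) (β q) (υ q)) p =
      frameVec m l γ (p 0) (pd i α p) (pd i β p) (pd i υ p)
        + α p • covAlong (bcvMetric m l) (hopfCylinder γ) i (fun q => horizontalLift m l γ (q 0)) p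
        + β p • covAlong (bcvMetric m l) (hopfCylinder γ) i (fun _ => vertical) p
        + υ p • covAlong (bcvMetric m l) (hopfCylinder γ) i
            (fun q => normalLift m l γ (q 0)) p := by
  have hX : DifferentiableAt ℝ (fun q : Fin 2 → ℝ => horizontalLift m l γ (q 0)) p :=
    (h.hasDerivAt_horizontalLift l hp).differentiableAt.comp p (f := fun q : Fin 2 → ℝ => q 0)
      (differentiableAt_apply 0 p)
  have hV : DifferentiableAt ℝ (fun _ : Fin 2 → ℝ => vertical) p := by fun_prop
  have hξ : DifferentiableAt ℝ (fun q : Fin 2 → ℝ => normalLift m l γ (q 0)) p :=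
    (h.hasDerivAt_normalLift l hp).differentiableAt.comp p (f := fun q : Fin 2 → ℝ => q 0)
      (differentiableAt_apply 0 p)
  simp only [frameVec]
  rw [covAlong_add ((hα.fun_smul hX).fun_add (hβ.fun_smul hV)) (hυ.fun_smul hξ),
    covAlong_add (hα.fun_smul hX) (hβ.fun_smul hV), covAlong_smul hα hX, covAlong_smul hβ hV,
    covAlong_smul hυ hξ]
  abel

theorem covAlong_zero_frameVec (h : IsUnitSpeedCurve m γ I) (l : ℝ) (hp : p 0 ∈ I)
    (hα : DifferentiableAt ℝ α p) (hβ : DifferentiableAt ℝ β p) (hυ : DifferentiableAt ℝ υ p) :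
    covAlong (bcvMetric m l) (hopfCylinder γ) 0
        (fun q => frameVec m l γ (q 0) (α q) (β q) (υ q)) p =
      frameVec m l γ (p 0)
        (pd 0 α p - (geodCurv m γ (p 0) + l / 2 * tilt m l γ (p 0)) * υ p)
        (pd 0 β p - l / 2 * υ p)
        (pd 0 υ p + (geodCurv m γ (p 0) + l / 2 * tilt m l γ (p 0)) * α p + l / 2 * β p) := by
  rw [h.covAlong_frameVec l hp hα hβ hυ, h.covAlong_zero_horizontalLift l hp,
    h.covAlong_zero_vertical l hp, h.covAlong_zero_normalLift l hp]
  simp only [frameVec]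
  module

theorem covAlong_one_frameVec (h : IsUnitSpeedCurve m γ I) (l : ℝ) (hp : p 0 ∈ I)
    (hα : DifferentiableAt ℝ α p) (hβ : DifferentiableAt ℝ β p) (hυ : DifferentiableAt ℝ υ p) :
    covAlong (bcvMetric m l) (hopfCylinder γ) 1
        (fun q => frameVec m l γ (q 0) (α q) (β q) (υ q)) p =
      frameVec m l γ (p 0) (pd 1 α p - l / 2 * υ p) (pd 1 β p) (pd 1 υ p + l / 2 * α p) := by
  rw [h.covAlong_frameVec l hp hα hβ hυ, h.covAlong_one_horizontalLift l hp,
    h.covAlong_one_vertical l hp, h.covAlong_one_normalLift l hp]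
  simp only [frameVec]
  module

end IsUnitSpeedCurve

theorem differentiableAt_pd {d : ℕ} {u : (Fin d → ℝ) → ℝ} {p : Fin d → ℝ}
    (hu : ContDiffAt ℝ 2 u p) (i : Fin d) : DifferentiableAt ℝ (pd i u) p :=
  ((hu.fderiv_right (m := 1) le_rfl).differentiableAt one_ne_zero).clm_apply
    (differentiableAt_const _)

/-! ### The tension field of a Hopf cylinder -/

/-- The coefficient matrix of the metric `(1 + t²) ds² + 2 t ds dz + dz²`. The metric induced on
a Hopf cylinder has this form, with `t` a function of `s`. -/
def shearMatrix (t : ℝ) : Matrix (Fin 2) (Fin 2) ℝ := !![1 + t ^ 2, t; t, 1]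

theorem inv_smul_shearMatrix_inv {a : ℝ} (ha : a ≠ 0) (t : ℝ) :
    (a⁻¹ • shearMatrix t)⁻¹ = a • !![1, -t; -t, 1 + t ^ 2] := by
  apply Matrix.inv_eq_right_inv
  ext i j
  fin_cases i <;> fin_cases j <;>
    simp [shearMatrix, Matrix.mul_apply, Fin.sum_univ_two] <;> field_simp <;> ring

section ShearMetric

variable {g : (Fin 2 → ℝ) → Matrix (Fin 2) (Fin 2) ℝ} {f : (Fin 2 → ℝ) → ℝ} {t : ℝ → ℝ} {t' : ℝ}
  {p : Fin 2 → ℝ}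

theorem hasDerivAt_shearMatrix {s : ℝ} (ht : HasDerivAt t t' s) (j k : Fin 2) :
    HasDerivAt (fun r => shearMatrix (t r) j k) (!![2 * t s * t', t'; t', 0] j k) s := by
  fin_cases j <;> fin_cases k
  exacts [((ht.pow 2).const_add 1).congr_deriv (by simp), ht, ht, hasDerivAt_const s 1]

theorem pd_of_eventuallyEq_shear (hg : g =ᶠ[nhds p] fun q => (f q)⁻¹ • shearMatrix (t (q 0)))
    (hf : DifferentiableAt ℝ f p) (hf0 : f p ≠ 0) (ht : HasDerivAt t t' (p 0)) (i j k : Fin 2) :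
    pd i (fun q => g q j k) p = -pd i f p / f p ^ 2 * shearMatrix (t (p 0)) j k
      + (f p)⁻¹ * if i = 0 then !![2 * t (p 0) * t', t'; t', 0] j k else 0 := by
  have hS := hasDerivAt_shearMatrix ht j k
  have hSd : DifferentiableAt ℝ (fun q : Fin 2 → ℝ => shearMatrix (t (q 0)) j k) p :=
    hS.differentiableAt.comp p (f := fun q : Fin 2 → ℝ => q 0) (differentiableAt_apply 0 p)
  rw [pd_congr (v := fun q => (f q)⁻¹ * shearMatrix (t (q 0)) j k)
    (hg.mono fun q hq => by simp [hq]), pd_mul (hf.fun_inv hf0) hSd, pd_inv hf hf0,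
    pd_comp_coord (g := fun r => shearMatrix (t r) j k) hS]
  ring

theorem trace_christoffel_shear (hg : g =ᶠ[nhds p] fun q => (f q)⁻¹ • shearMatrix (t (q 0)))
    (hf : DifferentiableAt ℝ f p) (hf0 : f p ≠ 0) (ht : HasDerivAt t t' (p 0)) (k : Fin 2) :
    ∑ i, ∑ j, (g p)⁻¹ i j * christoffel g k i j p = ![0, f p * t'] k := by
  simp only [christoffel, pd_of_eventuallyEq_shear hg hf hf0 ht, hg.eq_of_nhds,
    inv_smul_shearMatrix_inv hf0, Fin.sum_univ_two]
  fin_cases k <;> simp [shearMatrix] <;> field_simp <;> ring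

theorem trace_sub_christoffel_shear
    (hg : g =ᶠ[nhds p] fun q => (f q)⁻¹ • shearMatrix (t (q 0))) (hf : DifferentiableAt ℝ f p)
    (hf0 : f p ≠ 0) (ht : HasDerivAt t t' (p 0)) (A : Fin 2 → Fin 2 → ℝ) (B : Fin 2 → ℝ) :
    ∑ i, ∑ j, (g p)⁻¹ i j * (A i j - ∑ k, christoffel g k i j p * B k) =
      f p * (A 0 0 - t (p 0) * (A 0 1 + A 1 0) + (1 + t (p 0) ^ 2) * A 1 1 - t' * B 1) := by
  have h0 := trace_christoffel_shear hg hf hf0 ht 0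
  have h1 := trace_christoffel_shear hg hf hf0 ht 1
  simp only [hg.eq_of_nhds, inv_smul_shearMatrix_inv hf0, Fin.sum_univ_two, Matrix.smul_apply,
    smul_eq_mul, Matrix.of_apply, Matrix.cons_val', Matrix.cons_val_zero, Matrix.cons_val_one,
    Matrix.cons_val_fin_one] at h0 h1 ⊢
  linear_combination -B 0 * h0 - B 1 * h1

variable {n : ℕ} {h : (Fin n → ℝ) → Matrix (Fin n) (Fin n) ℝ} {φ : (Fin 2 → ℝ) → (Fin n → ℝ)}

theorem tension_shear (hg : g =ᶠ[nhds p] fun q => (f q)⁻¹ • shearMatrix (t (q 0)))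
    (hf : DifferentiableAt ℝ f p) (hf0 : f p ≠ 0) (ht : HasDerivAt t t' (p 0)) :
    tension g h φ p = f p • (covAlong h φ 0 (dmap φ 0) p
      - t (p 0) • (covAlong h φ 0 (dmap φ 1) p + covAlong h φ 1 (dmap φ 0) p)
      + (1 + t (p 0) ^ 2) • covAlong h φ 1 (dmap φ 1) p - t' • dmap φ 1 p) :=
  funext fun a => trace_sub_christoffel_shear hg hf hf0 ht
    (fun i j => covAlong h φ i (dmap φ j) p a) fun k => dmap φ k p a

theorem bitension_shear (hg : g =ᶠ[nhds p] fun q => (f q)⁻¹ • shearMatrix (t (q 0)))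
    (hf : DifferentiableAt ℝ f p) (hf0 : f p ≠ 0) (ht : HasDerivAt t t' (p 0)) :
    bitension g h φ p =
      f p • (covAlong h φ 0 (covAlong h φ 0 (tension g h φ)) p
        - t (p 0) • (covAlong h φ 0 (covAlong h φ 1 (tension g h φ)) p
          + covAlong h φ 1 (covAlong h φ 0 (tension g h φ)) p)
        + (1 + t (p 0) ^ 2) • covAlong h φ 1 (covAlong h φ 1 (tension g h φ)) p
        - t' • covAlong h φ 1 (tension g h φ) p)
      - f p • (curvatureOp h (φ p) (dmap φ 0 p) (tension g h φ p) (dmap φ 0 p)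
        - t (p 0) • (curvatureOp h (φ p) (dmap φ 0 p) (tension g h φ p) (dmap φ 1 p)
          + curvatureOp h (φ p) (dmap φ 1 p) (tension g h φ p) (dmap φ 0 p))
        + (1 + t (p 0) ^ 2) • curvatureOp h (φ p) (dmap φ 1 p) (tension g h φ p)
            (dmap φ 1 p)) := by
  funext a
  have htrace := trace_sub_christoffel_shear hg hf hf0 ht
    (fun i j => covAlong h φ i (covAlong h φ j (tension g h φ)) p a
      - curvatureOp h (φ p) (dmap φ i p) (tension g h φ p) (dmap φ j p) a)
    fun k => covAlong h φ k (tension g h φ) p a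
  simp only [bitension, sub_right_comm _ (∑ _, _), htrace, Pi.sub_apply, Pi.add_apply,
    Pi.smul_apply, smul_eq_mul]
  ring

end ShearMetric

theorem curvatureOp_bcvMetric (m l : ℝ) (P : Fin 3 → ℝ) (hF : conf m (P 0) (P 1) ≠ 0)
    (X Y Z : Fin 3 → ℝ) :
    curvatureOp (bcvMetric m l) P X Y Z =
      (4 * m - 3 * l ^ 2 / 4) • (ip (bcvMetric m l) P Y Z • X - ip (bcvMetric m l) P X Z • Y)
      - (4 * m - l ^ 2) • (((contactForm m l P ⬝ᵥ Y) * (contactForm m l P ⬝ᵥ Z)) • X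
        - ((contactForm m l P ⬝ᵥ X) * (contactForm m l P ⬝ᵥ Z)) • Y
        + (ip (bcvMetric m l) P Y Z * (contactForm m l P ⬝ᵥ X)
          - ip (bcvMetric m l) P X Z * (contactForm m l P ⬝ᵥ Y)) • vertical) := by
  funext a
  simp only [curvatureOp, curvature_bcvMetric m l P hF, bcvCurvature, ip, dotProduct,
    Fin.sum_univ_three, Pi.sub_apply, Pi.add_apply, Pi.smul_apply, smul_eq_mul]
  generalize bcvMetric m l P = h
  generalize contactForm m l P = η
  fin_cases a <;> simp [vertical] <;> ring

/-- The metric `f⁻¹ φ^*h` on the Hopf cylinder `φ` over `γ`. -/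
def rescaledMetric (m l : ℝ) (γ : ℝ → (Fin 2 → ℝ)) (f : (Fin 2 → ℝ) → ℝ) (p : Fin 2 → ℝ) :
    Matrix (Fin 2) (Fin 2) ℝ :=
  (f p)⁻¹ • pullbackMetric (bcvMetric m l) (hopfCylinder γ) p

/-- The function `u = f κ`, which is the component along the unit normal of the tension field of
the Hopf cylinder over `γ` with respect to `rescaledMetric`. -/
def normalTension (m : ℝ) (γ : ℝ → (Fin 2 → ℝ)) (f : (Fin 2 → ℝ) → ℝ) (p : Fin 2 → ℝ) : ℝ :=
  f p * geodCurv m γ (p 0)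

namespace IsUnitSpeedCurve

variable {m : ℝ} {γ : ℝ → (Fin 2 → ℝ)} {I : Set ℝ} {p : Fin 2 → ℝ} {f u : (Fin 2 → ℝ) → ℝ}

theorem eventually_mem (h : IsUnitSpeedCurve m γ I) (hp : p 0 ∈ I) : ∀ᶠ q in nhds p, q 0 ∈ I :=
  (h.isOpen.preimage (continuous_apply 0)).mem_nhds hp

theorem pullbackMetric_hopfCylinder (h : IsUnitSpeedCurve m γ I) (l : ℝ) (hp : p 0 ∈ I) :
    pullbackMetric (bcvMetric m l) (hopfCylinder γ) p = shearMatrix (tilt m l γ (p 0)) := by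
  have hip := h.ip_frameVec l hp (P := hopfCylinder γ p) rfl rfl
  ext i j
  fin_cases i <;> fin_cases j <;>
    simp [pullbackMetric, h.dmap_hopfCylinder_zero l hp, h.dmap_hopfCylinder_one l hp, hip,
      shearMatrix, pow_two]

theorem rescaledMetric_eventuallyEq (h : IsUnitSpeedCurve m γ I) (l : ℝ) (hp : p 0 ∈ I) :
    rescaledMetric m l γ f =ᶠ[nhds p] fun q => (f q)⁻¹ • shearMatrix (tilt m l γ (q 0)) := by
  filter_upwards [h.eventually_mem hp] with q hq
  rw [rescaledMetric, h.pullbackMetric_hopfCylinder l hq]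

theorem covAlong_zero_dmap_zero (h : IsUnitSpeedCurve m γ I) (l : ℝ) (hp : p 0 ∈ I) :
    covAlong (bcvMetric m l) (hopfCylinder γ) 0 (dmap (hopfCylinder γ) 0) p =
      frameVec m l γ (p 0) 0 (deriv (tilt m l γ) (p 0))
        (geodCurv m γ (p 0) + l * tilt m l γ (p 0)) := by
  have ht := (h.hasDerivAt_tilt l hp).differentiableAt
  have htd : DifferentiableAt ℝ (fun q : Fin 2 → ℝ => tilt m l γ (q 0)) p :=
    ht.comp p (f := fun q : Fin 2 → ℝ => q 0) (differentiableAt_apply 0 p)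
  rw [covAlong_congr ((h.eventually_mem hp).mono fun q hq => h.dmap_hopfCylinder_zero l hq),
    h.covAlong_zero_frameVec l hp (by fun_prop) htd (by fun_prop), pd_const, pd_const,
    pd_comp_coord ht.hasDerivAt]
  simp only [if_true]
  congr 1 <;> ring

theorem covAlong_dmap_one (h : IsUnitSpeedCurve m γ I) (l : ℝ) (hp : p 0 ∈ I) (i : Fin 2) :
    covAlong (bcvMetric m l) (hopfCylinder γ) i (dmap (hopfCylinder γ) 1) p =
      frameVec m l γ (p 0) 0 0 (if i = 0 then l / 2 else 0) := by
  rw [covAlong_congr ((h.eventually_mem hp).mono fun q hq => h.dmap_hopfCylinder_one l hq)]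
  fin_cases i
  · exact (h.covAlong_zero_frameVec l hp (by fun_prop) (by fun_prop) (by fun_prop)).trans
      (by simp [pd_const])
  · exact (h.covAlong_one_frameVec l hp (by fun_prop) (by fun_prop) (by fun_prop)).trans
      (by simp [pd_const])

theorem covAlong_one_dmap_zero (h : IsUnitSpeedCurve m γ I) (l : ℝ) (hp : p 0 ∈ I) :
    covAlong (bcvMetric m l) (hopfCylinder γ) 1 (dmap (hopfCylinder γ) 0) p =
      frameVec m l γ (p 0) 0 0 (l / 2) := by
  have ht := (h.hasDerivAt_tilt l hp).differentiableAt
  have htd : DifferentiableAt ℝ (fun q : Fin 2 → ℝ => tilt m l γ (q 0)) p :=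
    ht.comp p (f := fun q : Fin 2 → ℝ => q 0) (differentiableAt_apply 0 p)
  rw [covAlong_congr ((h.eventually_mem hp).mono fun q hq => h.dmap_hopfCylinder_zero l hq),
    h.covAlong_one_frameVec l hp (by fun_prop) htd (by fun_prop), pd_const, pd_const,
    pd_comp_coord ht.hasDerivAt]
  simp

theorem meanCurvature_hopfCylinder (h : IsUnitSpeedCurve m γ I) (l : ℝ) (hp : p 0 ∈ I) :
    meanCurvature (bcvMetric m l) (hopfCylinder γ) (hopfNormal m l γ) p =
      geodCurv m γ (p 0) / 2 := by
  have hip := h.ip_frameVec l hp (P := hopfCylinder γ p) rfl rfl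
  have hinv := inv_smul_shearMatrix_inv one_ne_zero (tilt m l γ (p 0))
  have hnormal : normalLift m l γ (p 0) = frameVec m l γ (p 0) 0 0 1 := by simp [frameVec]
  rw [inv_one, one_smul, one_smul] at hinv
  simp only [meanCurvature, h.pullbackMetric_hopfCylinder l hp, hinv,
    hopfNormal_eq m l γ p (h.conf_ne_zero _ hp), hnormal, Fin.sum_univ_two,
    h.covAlong_zero_dmap_zero l hp, h.covAlong_one_dmap_zero l hp, h.covAlong_dmap_one l hp, hip,
    Matrix.of_apply, Matrix.cons_val', Matrix.cons_val_zero, Matrix.cons_val_one,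
    Matrix.cons_val_fin_one, if_true, if_neg one_ne_zero]
  ring

theorem tension_hopfCylinder (h : IsUnitSpeedCurve m γ I) (l : ℝ) (hp : p 0 ∈ I)
    (hf : DifferentiableAt ℝ f p) (hf0 : f p ≠ 0) :
    tension (rescaledMetric m l γ f) (bcvMetric m l) (hopfCylinder γ) p =
      frameVec m l γ (p 0) 0 0 (normalTension m γ f p) := by
  rw [tension_shear (h.rescaledMetric_eventuallyEq l hp) hf hf0
      (h.hasDerivAt_tilt l hp).differentiableAt.hasDerivAt,
    h.covAlong_zero_dmap_zero l hp, h.covAlong_one_dmap_zero l hp, h.covAlong_dmap_one l hp,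
    h.covAlong_dmap_one l hp, h.dmap_hopfCylinder_one l hp, if_pos rfl, if_neg one_ne_zero]
  simp only [frameVec, normalTension]
  module

theorem curvatureOp_frameVec (h : IsUnitSpeedCurve m γ I) (l : ℝ) (hp : p 0 ∈ I)
    (a b a' b' c : ℝ) :
    curvatureOp (bcvMetric m l) (hopfCylinder γ p) (frameVec m l γ (p 0) a b 0)
        (frameVec m l γ (p 0) 0 0 c) (frameVec m l γ (p 0) a' b' 0) =
      frameVec m l γ (p 0) 0 0
        (-c * ((4 * m - 3 * l ^ 2 / 4) * (a * a') + l ^ 2 / 4 * (b * b'))) := by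
  have hip := h.ip_frameVec l hp (P := hopfCylinder γ p) rfl rfl
  simp only [curvatureOp_bcvMetric m l (hopfCylinder γ p) (h.conf_ne_zero _ hp), hip,
    h.contactForm_frameVec l hp]
  simp only [frameVec]
  module

theorem covAlong_zero_normal (h : IsUnitSpeedCurve m γ I) (l : ℝ) (hp : p 0 ∈ I)
    (hu : DifferentiableAt ℝ u p) :
    covAlong (bcvMetric m l) (hopfCylinder γ) 0 (fun q => frameVec m l γ (q 0) 0 0 (u q)) p =
      frameVec m l γ (p 0) (-((geodCurv m γ (p 0) + l / 2 * tilt m l γ (p 0)) * u p))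
        (-(l / 2 * u p)) (pd 0 u p) :=
  (h.covAlong_zero_frameVec l hp (by fun_prop) (by fun_prop) hu).trans (by simp [pd_const])

theorem covAlong_one_normal (h : IsUnitSpeedCurve m γ I) (l : ℝ) (hp : p 0 ∈ I)
    (hu : DifferentiableAt ℝ u p) :
    covAlong (bcvMetric m l) (hopfCylinder γ) 1 (fun q => frameVec m l γ (q 0) 0 0 (u q)) p =
      frameVec m l γ (p 0) (-(l / 2 * u p)) 0 (pd 1 u p) :=
  (h.covAlong_one_frameVec l hp (by fun_prop) (by fun_prop) hu).trans (by simp [pd_const])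

theorem hasDerivAt_normal_coeff (h : IsUnitSpeedCurve m γ I) (l : ℝ) (hp : p 0 ∈ I) :
    HasDerivAt (fun s => geodCurv m γ s + l / 2 * tilt m l γ s)
      (deriv (geodCurv m γ) (p 0) + l / 2 * deriv (tilt m l γ) (p 0)) (p 0) :=
  ((h.contDiffOn_geodCurv.contDiffAt (h.isOpen.mem_nhds hp)).differentiableAt
    (by simp)).hasDerivAt.add
    ((h.hasDerivAt_tilt l hp).differentiableAt.hasDerivAt.const_mul _)

theorem contDiffAt_normalTension (h : IsUnitSpeedCurve m γ I) (hp : p 0 ∈ I)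
    (hf : ContDiffAt ℝ 2 f p) : ContDiffAt ℝ 2 (normalTension m γ f) p := by
  have hκ : ContDiffAt ℝ 2 (geodCurv m γ) (p 0) :=
    (h.contDiffOn_geodCurv.contDiffAt (h.isOpen.mem_nhds hp)).of_le ENat.LEInfty.out
  exact hf.mul (hκ.comp p (f := fun q : Fin 2 → ℝ => q 0) (contDiff_apply ℝ ℝ 0).contDiffAt)

theorem covAlong_zero_covAlong_zero_normal (h : IsUnitSpeedCurve m γ I) (l : ℝ) (hp : p 0 ∈ I)
    (hu : ContDiffAt ℝ 2 u p) :
    covAlong (bcvMetric m l) (hopfCylinder γ) 0 (covAlong (bcvMetric m l) (hopfCylinder γ) 0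
        fun q => frameVec m l γ (q 0) 0 0 (u q)) p =
      frameVec m l γ (p 0)
        (-(2 * (geodCurv m γ (p 0) + l / 2 * tilt m l γ (p 0)) * pd 0 u p
          + (deriv (geodCurv m γ) (p 0) + l / 2 * deriv (tilt m l γ) (p 0)) * u p))
        (-(l * pd 0 u p))
        (pd 0 (pd 0 u) p
          - ((geodCurv m γ (p 0) + l / 2 * tilt m l γ (p 0)) ^ 2 + l ^ 2 / 4) * u p) := by
  have hud := hu.differentiableAt two_ne_zero
  have hc := h.hasDerivAt_normal_coeff l hp
  have hcd : DifferentiableAt ℝ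
      (fun q : Fin 2 → ℝ => geodCurv m γ (q 0) + l / 2 * tilt m l γ (q 0)) p :=
    hc.differentiableAt.comp p (f := fun q : Fin 2 → ℝ => q 0) (differentiableAt_apply 0 p)
  rw [covAlong_congr (((h.eventually_mem hp).and (hu.eventually (by simp))).mono fun q hq =>
      h.covAlong_zero_normal l hq.1 (hq.2.differentiableAt two_ne_zero)),
    h.covAlong_zero_frameVec l hp (hcd.fun_mul hud).fun_neg (by fun_prop)
      (differentiableAt_pd hu 0), pd_neg, pd_neg, pd_mul hcd hud, pd_mul (by fun_prop) hud,
    pd_const, pd_comp_coord hc, if_pos rfl]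
  congr 1 <;> ring

theorem covAlong_zero_covAlong_one_normal (h : IsUnitSpeedCurve m γ I) (l : ℝ) (hp : p 0 ∈ I)
    (hu : ContDiffAt ℝ 2 u p) :
    covAlong (bcvMetric m l) (hopfCylinder γ) 0 (covAlong (bcvMetric m l) (hopfCylinder γ) 1
        fun q => frameVec m l γ (q 0) 0 0 (u q)) p =
      frameVec m l γ (p 0)
        (-(l / 2 * pd 0 u p + (geodCurv m γ (p 0) + l / 2 * tilt m l γ (p 0)) * pd 1 u p))
        (-(l / 2 * pd 1 u p))
        (pd 0 (pd 1 u) p - l / 2 * (geodCurv m γ (p 0) + l / 2 * tilt m l γ (p 0)) * u p) := by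
  have hud := hu.differentiableAt two_ne_zero
  rw [covAlong_congr (((h.eventually_mem hp).and (hu.eventually (by simp))).mono fun q hq =>
      h.covAlong_one_normal l hq.1 (hq.2.differentiableAt two_ne_zero)),
    h.covAlong_zero_frameVec l hp (by fun_prop) (by fun_prop) (differentiableAt_pd hu 1),
    pd_neg, pd_mul (by fun_prop) hud, pd_const, pd_const]
  congr 1 <;> ring

theorem covAlong_one_covAlong_zero_normal (h : IsUnitSpeedCurve m γ I) (l : ℝ) (hp : p 0 ∈ I)
    (hu : ContDiffAt ℝ 2 u p) :
    covAlong (bcvMetric m l) (hopfCylinder γ) 1 (covAlong (bcvMetric m l) (hopfCylinder γ) 0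
        fun q => frameVec m l γ (q 0) 0 0 (u q)) p =
      frameVec m l γ (p 0)
        (-(l / 2 * pd 0 u p + (geodCurv m γ (p 0) + l / 2 * tilt m l γ (p 0)) * pd 1 u p))
        (-(l / 2 * pd 1 u p))
        (pd 1 (pd 0 u) p - l / 2 * (geodCurv m γ (p 0) + l / 2 * tilt m l γ (p 0)) * u p) := by
  have hud := hu.differentiableAt two_ne_zero
  have hc := h.hasDerivAt_normal_coeff l hp
  have hcd : DifferentiableAt ℝ
      (fun q : Fin 2 → ℝ => geodCurv m γ (q 0) + l / 2 * tilt m l γ (q 0)) p :=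
    hc.differentiableAt.comp p (f := fun q : Fin 2 → ℝ => q 0) (differentiableAt_apply 0 p)
  rw [covAlong_congr (((h.eventually_mem hp).and (hu.eventually (by simp))).mono fun q hq =>
      h.covAlong_zero_normal l hq.1 (hq.2.differentiableAt two_ne_zero)),
    h.covAlong_one_frameVec l hp (hcd.fun_mul hud).fun_neg (by fun_prop)
      (differentiableAt_pd hu 0), pd_neg, pd_neg, pd_mul hcd hud, pd_mul (by fun_prop) hud,
    pd_const, pd_comp_coord hc, if_neg one_ne_zero]
  congr 1 <;> ring

theorem covAlong_one_covAlong_one_normal (h : IsUnitSpeedCurve m γ I) (l : ℝ) (hp : p 0 ∈ I)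
    (hu : ContDiffAt ℝ 2 u p) :
    covAlong (bcvMetric m l) (hopfCylinder γ) 1 (covAlong (bcvMetric m l) (hopfCylinder γ) 1
        fun q => frameVec m l γ (q 0) 0 0 (u q)) p =
      frameVec m l γ (p 0) (-(l * pd 1 u p)) 0 (pd 1 (pd 1 u) p - l ^ 2 / 4 * u p) := by
  have hud := hu.differentiableAt two_ne_zero
  rw [covAlong_congr (((h.eventually_mem hp).and (hu.eventually (by simp))).mono fun q hq =>
      h.covAlong_one_normal l hq.1 (hq.2.differentiableAt two_ne_zero)),
    h.covAlong_one_frameVec l hp (by fun_prop) (by fun_prop) (differentiableAt_pd hu 1),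
    pd_neg, pd_mul (by fun_prop) hud, pd_const, pd_const]
  congr 1 <;> ring

theorem bitension_hopfCylinder (h : IsUnitSpeedCurve m γ I) (l : ℝ) (hp : p 0 ∈ I)
    (hf : ContDiffAt ℝ 2 f p) (hf0 : f p ≠ 0) (hu : u = normalTension m γ f) :
    bitension (rescaledMetric m l γ f) (bcvMetric m l) (hopfCylinder γ) p =
      frameVec m l γ (p 0)
        (-f p * (2 * geodCurv m γ (p 0) * (pd 0 u p - tilt m l γ (p 0) * pd 1 u p)
          + l * pd 1 u p + deriv (geodCurv m γ) (p 0) * u p))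
        (-f p * (l * (pd 0 u p - tilt m l γ (p 0) * pd 1 u p)))
        (f p * (pd 0 (pd 0 u) p - tilt m l γ (p 0) * (pd 0 (pd 1 u) p + pd 1 (pd 0 u) p)
          + (1 + tilt m l γ (p 0) ^ 2) * pd 1 (pd 1 u) p
          - deriv (tilt m l γ) (p 0) * pd 1 u p
          - (geodCurv m γ (p 0) ^ 2 + l ^ 2 - 4 * m) * u p)) := by
  have hud : ContDiffAt ℝ 2 u p := hu ▸ h.contDiffAt_normalTension hp hf
  have htension : tension (rescaledMetric m l γ f) (bcvMetric m l) (hopfCylinder γ) =ᶠ[nhds p]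
      fun q => frameVec m l γ (q 0) 0 0 (u q) := by
    filter_upwards [h.eventually_mem hp, hf.eventually (by simp),
      hf.continuousAt.eventually_ne hf0] with q hq hfq hfq0
    rw [h.tension_hopfCylinder l hq (hfq.differentiableAt two_ne_zero) hfq0, hu]
  have hcov : ∀ i, covAlong (bcvMetric m l) (hopfCylinder γ) i
      (tension (rescaledMetric m l γ f) (bcvMetric m l) (hopfCylinder γ)) =ᶠ[nhds p]
        covAlong (bcvMetric m l) (hopfCylinder γ) i fun q => frameVec m l γ (q 0) 0 0 (u q) :=
    fun _ => htension.eventuallyEq_nhds.mono fun _ => covAlong_congr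
  rw [bitension_shear (h.rescaledMetric_eventuallyEq l hp) (hf.differentiableAt two_ne_zero) hf0
      (h.hasDerivAt_tilt l hp).differentiableAt.hasDerivAt]
  simp only [covAlong_congr (hcov _), (hcov 1).eq_of_nhds, htension.eq_of_nhds,
    h.covAlong_zero_covAlong_zero_normal l hp hud, h.covAlong_zero_covAlong_one_normal l hp hud,
    h.covAlong_one_covAlong_zero_normal l hp hud, h.covAlong_one_covAlong_one_normal l hp hud,
    h.covAlong_one_normal l hp (hud.differentiableAt two_ne_zero),
    h.dmap_hopfCylinder_zero l hp, h.dmap_hopfCylinder_one l hp, h.curvatureOp_frameVec l hp]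
  simp only [frameVec]
  module

end IsUnitSpeedCurve

/-! ### Linear and Ermakov ordinary differential equations -/

theorem eq_of_hasDerivAt_zero {S : Set ℝ} (hS : IsOpen S) (hS' : S.OrdConnected) {g : ℝ → ℝ}
    (hg : ∀ x ∈ S, HasDerivAt g 0 x) {x y : ℝ} (hx : x ∈ S) (hy : y ∈ S) : g x = g y :=
  hS.is_const_of_deriv_eq_zero hS'.isPreconnected
    (fun x hx => (hg x hx).differentiableAt.differentiableWithinAt)
    (fun x hx => (hg x hx).deriv) hx hy

/-- On the set `S` the function `y` is twice differentiable with second derivative `g`. A second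
order differential equation for `y` is expressed by letting `g` depend on `y`. -/
def HasSecondDerivOn (y g : ℝ → ℝ) (S : Set ℝ) : Prop :=
  ∀ x ∈ S, HasDerivAt y (deriv y x) x ∧ HasDerivAt (deriv y) (g x) x

namespace HasSecondDerivOn

variable {S : Set ℝ} {y y₁ g g₁ : ℝ → ℝ} {ρ : ℝ}

theorem of_hasDerivAt {y' : ℝ → ℝ} (hS : IsOpen S) (hy : ∀ x ∈ S, HasDerivAt y (y' x) x)
    (hy' : ∀ x ∈ S, HasDerivAt y' (g x) x) : HasSecondDerivOn y g S := fun x hx =>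
  ⟨(hy x hx).differentiableAt.hasDerivAt, (hy' x hx).congr_of_eventuallyEq
    (Filter.eventuallyEq_of_mem (hS.mem_nhds hx) fun t ht => (hy t ht).deriv)⟩

theorem congr (hS : IsOpen S) (h : HasSecondDerivOn y g S) (hy : ∀ x ∈ S, y₁ x = y x)
    (hg : ∀ x ∈ S, g x = g₁ x) : HasSecondDerivOn y₁ g₁ S :=
  of_hasDerivAt hS
    (fun x hx => (h x hx).1.congr_of_eventuallyEq (Filter.eventuallyEq_of_mem (hS.mem_nhds hx) hy))
    fun x hx => (h x hx).2.congr_deriv (hg x hx)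

theorem const_mul (h : HasSecondDerivOn y g S) (hS : IsOpen S) (c : ℝ) :
    HasSecondDerivOn (fun x => c * y x) (fun x => c * g x) S :=
  of_hasDerivAt hS (fun x hx => (h x hx).1.const_mul c) fun x hx => (h x hx).2.const_mul c

theorem unique (hS : IsOpen S) (h : HasSecondDerivOn y g S) (h₁ : HasSecondDerivOn y₁ g₁ S)
    (hy : ∀ x ∈ S, y x = y₁ x) {x : ℝ} (hx : x ∈ S) : g x = g₁ x :=
  (h x hx).2.unique ((congr hS h₁ hy fun _ _ => rfl) x hx).2

theorem exists_eq_exp (hS : IsOpen S) (hS' : S.OrdConnected) (hne : S.Nonempty) (hρ : ρ ≠ 0)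
    (h : HasSecondDerivOn y (fun x => ρ ^ 2 * y x) S) :
    ∃ a b : ℝ, ∀ x ∈ S, y x = a * Real.exp (ρ * x) + b * Real.exp (-(ρ * x)) ∧
      deriv y x = ρ * (a * Real.exp (ρ * x) - b * Real.exp (-(ρ * x))) := by
  obtain ⟨x₀, hx₀⟩ := hne
  have hlin (x : ℝ) : HasDerivAt (fun x => ρ * x) ρ x := hasDerivAt_const_mul ρ
  have hexp (x : ℝ) : Real.exp (-(ρ * x)) * Real.exp (ρ * x) = 1 := by
    rw [← Real.exp_add, neg_add_cancel, Real.exp_zero]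
  -- the two first integrals `(y' ± ρ y) e^{∓ρx}`
  have hminus {x : ℝ} (hx : x ∈ S) : (deriv y x + ρ * y x) * Real.exp (-(ρ * x)) =
      (deriv y x₀ + ρ * y x₀) * Real.exp (-(ρ * x₀)) :=
    eq_of_hasDerivAt_zero hS hS' (g := fun x => (deriv y x + ρ * y x) * Real.exp (-(ρ * x)))
      (fun t ht => (((h t ht).2.add ((h t ht).1.const_mul ρ)).mul (hlin t).fun_neg.exp).congr_deriv
        (by simp only [Pi.add_apply]; ring)) hx hx₀
  have hplus {x : ℝ} (hx : x ∈ S) : (deriv y x - ρ * y x) * Real.exp (ρ * x) =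
      (deriv y x₀ - ρ * y x₀) * Real.exp (ρ * x₀) :=
    eq_of_hasDerivAt_zero hS hS' (g := fun x => (deriv y x - ρ * y x) * Real.exp (ρ * x))
      (fun t ht => (((h t ht).2.sub ((h t ht).1.const_mul ρ)).mul (hlin t).exp).congr_deriv
        (by simp only [Pi.sub_apply]; ring)) hx hx₀
  refine ⟨(deriv y x₀ + ρ * y x₀) * Real.exp (-(ρ * x₀)) / (2 * ρ),
    -((deriv y x₀ - ρ * y x₀) * Real.exp (ρ * x₀)) / (2 * ρ), fun x hx => ?_⟩
  rw [← hminus hx, ← hplus hx]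
  constructor
  · field_simp
    linear_combination -(2 * ρ * y x) * hexp x
  · field_simp
    linear_combination -2 * deriv y x * hexp x

theorem exists_eq_sin_cos (hS : IsOpen S) (hS' : S.OrdConnected) (hne : S.Nonempty) (hρ : ρ ≠ 0)
    (h : HasSecondDerivOn y (fun x => -ρ ^ 2 * y x) S) :
    ∃ a b : ℝ, ∀ x ∈ S, y x = a * Real.sin (ρ * x) + b * Real.cos (ρ * x) ∧
      deriv y x = ρ * (a * Real.cos (ρ * x) - b * Real.sin (ρ * x)) := by
  obtain ⟨x₀, hx₀⟩ := hne
  have hlin (x : ℝ) : HasDerivAt (fun x => ρ * x) ρ x := hasDerivAt_const_mul ρ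
  have hsin {x : ℝ} (hx : x ∈ S) :
      ρ * y x * Real.sin (ρ * x) + deriv y x * Real.cos (ρ * x) =
        ρ * y x₀ * Real.sin (ρ * x₀) + deriv y x₀ * Real.cos (ρ * x₀) :=
    eq_of_hasDerivAt_zero hS hS'
      (g := fun x => ρ * y x * Real.sin (ρ * x) + deriv y x * Real.cos (ρ * x))
      (fun t ht => ((((h t ht).1.const_mul ρ).mul (hlin t).sin).add
        ((h t ht).2.mul (hlin t).cos)).congr_deriv (by ring)) hx hx₀
  have hcos {x : ℝ} (hx : x ∈ S) :
      ρ * y x * Real.cos (ρ * x) - deriv y x * Real.sin (ρ * x) =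
        ρ * y x₀ * Real.cos (ρ * x₀) - deriv y x₀ * Real.sin (ρ * x₀) :=
    eq_of_hasDerivAt_zero hS hS'
      (g := fun x => ρ * y x * Real.cos (ρ * x) - deriv y x * Real.sin (ρ * x))
      (fun t ht => ((((h t ht).1.const_mul ρ).mul (hlin t).cos).sub
        ((h t ht).2.mul (hlin t).sin)).congr_deriv (by ring)) hx hx₀
  refine ⟨(ρ * y x₀ * Real.sin (ρ * x₀) + deriv y x₀ * Real.cos (ρ * x₀)) / ρ,
    (ρ * y x₀ * Real.cos (ρ * x₀) - deriv y x₀ * Real.sin (ρ * x₀)) / ρ, fun x hx => ?_⟩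
  rw [← hsin hx, ← hcos hx]
  have htrig := Real.sin_sq_add_cos_sq (ρ * x)
  constructor
  · field_simp
    linear_combination -(ρ * y x) * htrig
  · field_simp
    linear_combination -deriv y x * htrig

theorem exists_eq_affine (hS : IsOpen S) (hS' : S.OrdConnected)
    (h : HasSecondDerivOn y (fun _ => 0) S) :
    ∃ a b : ℝ, ∀ x ∈ S, y x = a * x + b ∧ deriv y x = a := by
  rcases S.eq_empty_or_nonempty with rfl | ⟨x₀, hx₀⟩
  · exact ⟨0, 0, fun _ => False.elim⟩
  have hslope {x : ℝ} (hx : x ∈ S) : deriv y x = deriv y x₀ :=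
    eq_of_hasDerivAt_zero hS hS' (fun t ht => (h t ht).2) hx hx₀
  have hintercept {x : ℝ} (hx : x ∈ S) : y x - deriv y x₀ * x = y x₀ - deriv y x₀ * x₀ :=
    eq_of_hasDerivAt_zero hS hS' (g := fun x => y x - deriv y x₀ * x)
      (fun t ht => ((h t ht).1.sub (hasDerivAt_const_mul _)).congr_deriv
        (by rw [hslope ht, sub_self])) hx hx₀
  exact ⟨deriv y x₀, y x₀ - deriv y x₀ * x₀, fun x hx =>
    ⟨by linarith [hintercept hx], hslope hx⟩⟩

theorem isFibreSolution {K : ℝ} (hS : IsOpen S) (hS' : S.OrdConnected) (hne : S.Nonempty)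
    (h : HasSecondDerivOn y (fun x => K * y x) S) : IsFibreSolution K S y := by
  rcases lt_trichotomy K 0 with hK | rfl | hK
  · have hsq : -√(-K) ^ 2 = K := by rw [Real.sq_sqrt (by linarith), neg_neg]
    obtain ⟨a, b, hab⟩ := exists_eq_sin_cos hS hS' hne (ρ := √(-K))
      (Real.sqrt_pos.2 (neg_pos.2 hK)).ne' (by rwa [hsq])
    exact Or.inl ⟨hK, a, b, fun x hx => (hab x hx).1⟩
  · obtain ⟨a, b, hab⟩ := exists_eq_affine hS hS' (by simpa only [zero_mul] using h)
    exact Or.inr (Or.inl ⟨rfl, a, b, fun x hx => (hab x hx).1⟩)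
  · obtain ⟨a, b, hab⟩ := exists_eq_exp hS hS' hne (ρ := √K)
      (Real.sqrt_pos.2 hK).ne' (by rwa [Real.sq_sqrt hK.le])
    exact Or.inr (Or.inr ⟨hK, a, b, fun x hx => (hab x hx).1⟩)

end HasSecondDerivOn

theorem IsFibreSolution.exists_eq_of_pos {K : ℝ} (hK : K ≤ 0) {ψ : ℝ → ℝ}
    (h : IsFibreSolution K Set.univ ψ) (hpos : ∀ z, 0 < ψ z) : ∃ c, ∀ z, ψ z = c := by
  rcases h with ⟨hK', a, b, h⟩ | ⟨-, a, b, h⟩ | ⟨hK', -⟩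
  · exfalso
    -- `ψ` takes opposite values at the ends of a half-period
    have hzero := hpos 0
    have hpi := hpos (Real.pi / √(-K))
    rw [h _ trivial] at hzero hpi
    rw [mul_div_cancel₀ _ (Real.sqrt_pos.2 (neg_pos.2 hK')).ne'] at hpi
    simp only [mul_zero, Real.sin_zero, Real.cos_zero, mul_one, zero_add, Real.sin_pi,
      Real.cos_pi, mul_neg, Left.neg_pos_iff] at hzero hpi
    linarith
  · refine ⟨b, fun z => ?_⟩
    suffices a = 0 by rw [h z trivial, this, zero_mul, zero_add]
    by_contra ha
    have hneg := hpos (-(b + 1) / a)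
    rw [h _ trivial, mul_div_cancel₀ _ ha] at hneg
    linarith
  · exact absurd hK' hK.not_gt

section CurvatureSolution

variable {I : Set ℝ} {v : ℝ → ℝ} {Q c : ℝ}

theorem exists_eq_exp_add_of_sq_deriv (hI : IsOpen I) (hI' : I.OrdConnected) (hne : I.Nonempty)
    (hQ : Q < 0) (hv : HasSecondDerivOn v (fun s => -(4 * Q) * (v s - c)) I)
    (hsq : ∀ s ∈ I, deriv v s ^ 2 = -(4 * Q) * ((v s - c) ^ 2 - (c ^ 2 - 1 / Q))) :
    ∃ C D ε : ℝ, (ε = 1 ∨ ε = -1) ∧ 0 ≤ 4 * C * D + 1 / Q ∧ ∀ s ∈ I, v s =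
      C * Real.exp (2 * √(-Q) * s) + D * Real.exp (-(2 * √(-Q) * s))
        + ε * √(4 * C * D + 1 / Q) := by
  have hρ : (2 * √(-Q)) ^ 2 = -(4 * Q) := by rw [mul_pow, Real.sq_sqrt (by linarith)]; ring
  have hρ0 : 2 * √(-Q) ≠ 0 := (mul_pos two_pos (Real.sqrt_pos.2 (neg_pos.2 hQ))).ne'
  obtain ⟨C, D, hCD⟩ := HasSecondDerivOn.exists_eq_exp hI hI' hne hρ0
    (y := fun s => v s - c) (.of_hasDerivAt hI (fun s hs => (hv s hs).1.sub_const c)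
      fun s hs => hρ ▸ (hv s hs).2)
  have hdisc : 4 * C * D + 1 / Q = c ^ 2 := by
    obtain ⟨s, hs⟩ := hne
    obtain ⟨hval, hder⟩ := hCD s hs
    have hexp : Real.exp (2 * √(-Q) * s) * Real.exp (-(2 * √(-Q) * s)) = 1 := by
      rw [← Real.exp_add, add_neg_cancel, Real.exp_zero]
    have hs' := hsq s hs
    rw [← deriv_sub_const (f := v) c, hder, hval, mul_pow, hρ] at hs'
    have hcancel := mul_left_cancel₀ (by linarith : -(4 * Q) ≠ 0) hs'
    linear_combination (-4 * C * D) * hexp - hcancel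
  obtain ⟨ε, hε, hεc⟩ : ∃ ε : ℝ, (ε = 1 ∨ ε = -1) ∧ c = ε * |c| := by
    rcases abs_choice c with habs | habs
    · exact ⟨1, Or.inl rfl, by rw [one_mul, habs]⟩
    · exact ⟨-1, Or.inr rfl, by rw [habs, neg_mul_neg, one_mul]⟩
  refine ⟨C, D, ε, hε, hdisc ▸ sq_nonneg c, fun s hs => ?_⟩
  rw [hdisc, Real.sqrt_sq_eq_abs, ← hεc, ← (hCD s hs).1, sub_add_cancel]

theorem exists_eq_cos_add_of_sq_deriv (hI : IsOpen I) (hI' : I.OrdConnected) (hne : I.Nonempty)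
    (hQ : 0 < Q) (hpos : ∀ s ∈ I, 0 < v s)
    (hv : HasSecondDerivOn v (fun s => -(4 * Q) * (v s - c)) I)
    (hsq : ∀ s ∈ I, deriv v s ^ 2 = -(4 * Q) * ((v s - c) ^ 2 - (c ^ 2 - 1 / Q))) :
    ∃ C D : ℝ, ∀ s ∈ I, v s =
      C * Real.cos (2 * √Q * s) + D * Real.sin (2 * √Q * s) + √(1 / Q + (C ^ 2 + D ^ 2)) := by
  have hρ : (2 * √Q) ^ 2 = 4 * Q := by rw [mul_pow, Real.sq_sqrt hQ.le]; ring
  have hρ0 : 2 * √Q ≠ 0 := (mul_pos two_pos (Real.sqrt_pos.2 hQ)).ne'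
  obtain ⟨D, C, hCD⟩ := HasSecondDerivOn.exists_eq_sin_cos hI hI' hne hρ0
    (y := fun s => v s - c) (.of_hasDerivAt hI (fun s hs => (hv s hs).1.sub_const c)
      fun s hs => hρ ▸ (hv s hs).2)
  obtain ⟨s₀, hs₀⟩ := hne
  have hdisc : 1 / Q + (C ^ 2 + D ^ 2) = c ^ 2 := by
    obtain ⟨hval, hder⟩ := hCD s₀ hs₀
    have hs' := hsq s₀ hs₀
    rw [← deriv_sub_const (f := v) c, hder, hval, mul_pow, hρ] at hs'
    have hcancel := mul_left_cancel₀ (by linarith : 4 * Q ≠ 0) (hs'.trans (neg_mul_comm _ _))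
    linear_combination hcancel - (C ^ 2 + D ^ 2) * Real.sin_sq_add_cos_sq (2 * √Q * s₀)
  have hc : 0 < c := by
    have hv0 := hpos s₀ hs₀
    have hle : (v s₀ - c) ^ 2 - (c ^ 2 - 1 / Q) ≤ 0 :=
      nonpos_of_mul_nonneg_right (hsq s₀ hs₀ ▸ sq_nonneg _) (by linarith)
    have hinv := one_div_pos.2 hQ
    nlinarith
  refine ⟨C, D, fun s hs => ?_⟩
  rw [hdisc, Real.sqrt_sq hc.le]
  linarith [(hCD s hs).1]

theorem exists_eq_quadratic_of_sq_deriv {e : ℝ} (hI : IsOpen I) (hI' : I.OrdConnected)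
    (hne : I.Nonempty) (hpos : ∀ s ∈ I, 0 < v s) (hv : HasSecondDerivOn v (fun _ => 2 * e) I)
    (hsq : ∀ s ∈ I, deriv v s ^ 2 = 4 * e * v s - 4) :
    ∃ C D : ℝ, C ≠ 0 ∧ ∀ s ∈ I, v s = (16 + C ^ 2 * (s + D) ^ 2) / (4 * C) := by
  have hpar (s : ℝ) : HasDerivAt (fun s => e * s ^ 2) (2 * e * s) s :=
    ((hasDerivAt_pow 2 s).const_mul e).congr_deriv (by push_cast; ring)
  obtain ⟨a, b, hab⟩ := HasSecondDerivOn.exists_eq_affine hI hI' (y := fun s => v s - e * s ^ 2)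
    (.of_hasDerivAt hI (fun s hs => (hv s hs).1.sub (hpar s))
      fun s hs => ((hv s hs).2.sub (hasDerivAt_const_mul (2 * e))).congr_deriv (sub_self _))
  obtain ⟨s₀, hs₀⟩ := hne
  have he : 0 < e := by
    by_contra! hcon
    nlinarith [hsq s₀ hs₀, hpos s₀ hs₀, sq_nonneg (deriv v s₀)]
  have hdisc : a ^ 2 = 4 * e * b - 4 := by
    have hder : deriv v s₀ - 2 * e * s₀ = a :=
      ((hv s₀ hs₀).1.sub (hpar s₀)).deriv.symm.trans (hab s₀ hs₀).2
    have hs' := hsq s₀ hs₀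
    rw [sub_eq_iff_eq_add.1 hder, sub_eq_iff_eq_add.1 (hab s₀ hs₀).1] at hs'
    linarith
  refine ⟨4 * e, a / (2 * e), by positivity, fun s hs => ?_⟩
  rw [sub_eq_iff_eq_add.1 (hab s hs).1]
  field_simp
  linear_combination -16 * hdisc

end CurvatureSolution

section Ermakov

variable {I : Set ℝ} {w : ℝ → ℝ} {Q : ℝ}

theorem exists_ermakov_energy (hI : IsOpen I) (hI' : I.OrdConnected) (hpos : ∀ s ∈ I, 0 < w s)
    (hw : HasSecondDerivOn w (fun s => (w s ^ 3)⁻¹ - Q * w s) I) :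
    ∃ e, ∀ s ∈ I, deriv w s ^ 2 + (w s ^ 2)⁻¹ + Q * w s ^ 2 = e := by
  rcases I.eq_empty_or_nonempty with rfl | ⟨s₀, hs₀⟩
  · exact ⟨0, fun _ => False.elim⟩
  refine ⟨_, fun s hs => eq_of_hasDerivAt_zero hI hI'
    (g := fun s => deriv w s ^ 2 + (w s ^ 2)⁻¹ + Q * w s ^ 2) (fun t ht => ?_) hs hs₀⟩
  obtain ⟨hwt, hwt'⟩ := hw t ht
  have hne := (hpos t ht).ne'
  refine (((hwt'.fun_pow 2).add ((hwt.fun_pow 2).fun_inv (pow_ne_zero 2 hne))).add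
    ((hwt.fun_pow 2).const_mul Q)).congr_deriv ?_
  push_cast
  field_simp
  ring

theorem hasSecondDerivOn_sq_of_ermakov {e : ℝ} (hI : IsOpen I) (hpos : ∀ s ∈ I, 0 < w s)
    (hw : HasSecondDerivOn w (fun s => (w s ^ 3)⁻¹ - Q * w s) I)
    (he : ∀ s ∈ I, deriv w s ^ 2 + (w s ^ 2)⁻¹ + Q * w s ^ 2 = e) :
    HasSecondDerivOn (fun s => w s ^ 2) (fun s => 2 * e - 4 * Q * w s ^ 2) I := by
  refine .of_hasDerivAt hI (y' := fun s => 2 * w s * deriv w s)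
    (fun s hs => ((hw s hs).1.fun_pow 2).congr_deriv (by ring)) fun s hs => ?_
  have hne := (hpos s hs).ne'
  refine (((hw s hs).1.const_mul 2).mul (hw s hs).2).congr_deriv ?_
  rw [← he s hs]
  field_simp
  ring

theorem sq_deriv_sq_of_ermakov {e : ℝ} (hpos : ∀ s ∈ I, 0 < w s)
    (hw : ∀ s ∈ I, HasDerivAt w (deriv w s) s)
    (he : ∀ s ∈ I, deriv w s ^ 2 + (w s ^ 2)⁻¹ + Q * w s ^ 2 = e) :
    ∀ s ∈ I, deriv (fun s => w s ^ 2) s ^ 2 = 4 * e * w s ^ 2 - 4 - 4 * Q * (w s ^ 2) ^ 2 := by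
  intro s hs
  have hne := (hpos s hs).ne'
  rw [((hw s hs).fun_pow 2).deriv, ← he s hs]
  push_cast
  field_simp
  ring

theorem isCurvatureSolution_of_ermakov {m K : ℝ} {k : ℝ → ℝ} (hI : IsOpen I)
    (hI' : I.OrdConnected) (hne : I.Nonempty) (hpos : ∀ s ∈ I, 0 < w s)
    (hk : ∀ s ∈ I, k s = 1 / w s ^ 2)
    (hw : HasSecondDerivOn w (fun s => (w s ^ 3)⁻¹ - (4 * m + K) * w s) I) :
    IsCurvatureSolution m K I k := by
  obtain ⟨e, he⟩ := exists_ermakov_energy hI hI' hpos hw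
  have hv := hasSecondDerivOn_sq_of_ermakov hI hpos hw he
  have hsq := sq_deriv_sq_of_ermakov hpos (fun s hs => (hw s hs).1) he
  have hvpos : ∀ s ∈ I, 0 < w s ^ 2 := fun s hs => pow_pos (hpos s hs) 2
  unfold IsCurvatureSolution
  generalize 4 * m + K = Q at hv hsq ⊢
  have hcenter (hQ : Q ≠ 0) : HasSecondDerivOn (fun s => w s ^ 2)
      (fun s => -(4 * Q) * (w s ^ 2 - e / (2 * Q))) I :=
    hv.congr hI (fun _ _ => rfl) fun s _ => by field_simp; ring
  have hsq_center (hQ : Q ≠ 0) : ∀ s ∈ I, deriv (fun s => w s ^ 2) s ^ 2 =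
      -(4 * Q) * ((w s ^ 2 - e / (2 * Q)) ^ 2 - ((e / (2 * Q)) ^ 2 - 1 / Q)) := fun s hs => by
    rw [hsq s hs]; field_simp; ring
  rcases lt_trichotomy Q 0 with hQ | rfl | hQ
  · obtain ⟨C, D, ε, hε, hCD, h⟩ :=
      exists_eq_exp_add_of_sq_deriv hI hI' hne hQ (hcenter hQ.ne) (hsq_center hQ.ne)
    exact Or.inl ⟨hQ, C, D, ε, hε, hCD,
      fun s hs => (hk s hs).trans (congrArg (1 / ·) (h s hs))⟩
  · obtain ⟨C, D, -, h⟩ := exists_eq_quadratic_of_sq_deriv hI hI' hne hvpos (e := e)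
      (by simpa using hv) (by simpa using hsq)
    exact Or.inr (Or.inl ⟨rfl, C, D, fun s hs =>
      (hk s hs).trans ((congrArg (1 / ·) (h s hs)).trans (one_div_div _ _))⟩)
  · obtain ⟨C, D, h⟩ :=
      exists_eq_cos_add_of_sq_deriv hI hI' hne hQ hvpos (hcenter hQ.ne') (hsq_center hQ.ne')
    exact Or.inr (Or.inr ⟨hQ, C, D, fun s hs => (hk s hs).trans (congrArg (1 / ·) (h s hs))⟩)

end Ermakov

/-! ### The biharmonic equations -/

section CylinderDomain

variable {I J : Set ℝ} {u : (Fin 2 → ℝ) → ℝ} {s z : ℝ}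

theorem isOpen_cylinderDomain (hI : IsOpen I) (hJ : IsOpen J) : IsOpen (cylinderDomain I J) :=
  (hI.preimage (continuous_apply 0)).inter (hJ.preimage (continuous_apply 1))

theorem convex_cylinderDomain (hI : I.OrdConnected) (hJ : J.OrdConnected) :
    Convex ℝ (cylinderDomain I J) :=
  (hI.convex.linear_preimage (LinearMap.proj (R := ℝ) (φ := fun _ : Fin 2 => ℝ) 0)).inter
    (hJ.convex.linear_preimage (LinearMap.proj (R := ℝ) (φ := fun _ : Fin 2 => ℝ) 1))

theorem hasDerivAt_slice_zero (hu : DifferentiableAt ℝ u ![s, z]) :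
    HasDerivAt (fun t => u ![t, z]) (pd 0 u ![s, z]) s := by
  have hupdate (t : ℝ) : Function.update ![s, z] 0 t = ![t, z] := by
    ext i; fin_cases i <;> rfl
  simpa only [hupdate] using hasDerivAt_comp_update (p := ![s, z]) (i := 0) (t := s)
    (by rwa [hupdate])

theorem hasDerivAt_slice_one (hu : DifferentiableAt ℝ u ![s, z]) :
    HasDerivAt (fun t => u ![s, t]) (pd 1 u ![s, z]) z := by
  have hupdate (t : ℝ) : Function.update ![s, z] 1 t = ![s, t] := by
    ext i; fin_cases i <;> rfl
  simpa only [hupdate] using hasDerivAt_comp_update (p := ![s, z]) (i := 1) (t := z)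
    (by rwa [hupdate])

end CylinderDomain

/-- The analytic form of biharmonicity of a Hopf cylinder with conformal factor `f`: the components
of the bitension field along the adapted frame vanish. Here `κ` and `t` stand for the geodesic
curvature and the tilt of the base curve, and `u = f κ` for the normal component of the tension
field. -/
structure BiharmonicSystem (m l : ℝ) (t κ : ℝ → ℝ) (I J : Set ℝ) (f u : (Fin 2 → ℝ) → ℝ) :
    Prop where
  isOpen_left : IsOpen I
  ordConnected_left : I.OrdConnected
  isOpen_right : IsOpen J
  ordConnected_right : J.OrdConnected
  contDiffOn_curvature : ContDiffOn ℝ ∞ κ I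
  differentiableAt_tilt : ∀ s ∈ I, DifferentiableAt ℝ t s
  contDiffOn_factor : ContDiffOn ℝ ∞ f (cylinderDomain I J)
  factor_pos : ∀ p ∈ cylinderDomain I J, 0 < f p
  eq_mul : u = fun p => f p * κ (p 0)
  tangential_horizontal : ∀ p ∈ cylinderDomain I J,
    2 * κ (p 0) * (pd 0 u p - t (p 0) * pd 1 u p) + l * pd 1 u p + deriv κ (p 0) * u p = 0
  tangential_vertical : ∀ p ∈ cylinderDomain I J, l * (pd 0 u p - t (p 0) * pd 1 u p) = 0
  normal : ∀ p ∈ cylinderDomain I J,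
    pd 0 (pd 0 u) p - t (p 0) * (pd 0 (pd 1 u) p + pd 1 (pd 0 u) p)
        + (1 + t (p 0) ^ 2) * pd 1 (pd 1 u) p - deriv t (p 0) * pd 1 u p =
      (κ (p 0) ^ 2 + l ^ 2 - 4 * m) * u p

theorem IsUnitSpeedCurve.biharmonicSystem {m l : ℝ} {γ : ℝ → (Fin 2 → ℝ)} {I J : Set ℝ}
    {f : (Fin 2 → ℝ) → ℝ} (h : IsUnitSpeedCurve m γ I) (hI : I.OrdConnected) (hJ : IsOpen J)
    (hJ' : J.OrdConnected) (hf : ContDiffOn ℝ ∞ f (cylinderDomain I J))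
    (hfpos : ∀ p ∈ cylinderDomain I J, 0 < f p)
    (hbi : IsBiharmonicMap (cylinderDomain I J) (rescaledMetric m l γ f) (bcvMetric m l)
      (hopfCylinder γ)) :
    BiharmonicSystem m l (tilt m l γ) (geodCurv m γ) I J f (normalTension m γ f) := by
  have hcomp (p) (hp : p ∈ cylinderDomain I J) := by
    have hU := (isOpen_cylinderDomain h.isOpen hJ).mem_nhds hp
    have hbip := hbi p hp
    rw [h.bitension_hopfCylinder l hp.1 ((hf.contDiffAt hU).of_le ENat.LEInfty.out)
      (hfpos p hp).ne' rfl] at hbip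
    exact h.frameVec_eq_zero hp.1 hbip
  refine ⟨h.isOpen, hI, hJ, hJ', h.contDiffOn_geodCurv,
    fun s hs => (h.hasDerivAt_tilt l hs).differentiableAt, hf, hfpos, rfl, fun p hp => ?_,
    fun p hp => ?_, fun p hp => ?_⟩
  · exact (mul_eq_zero.1 (hcomp p hp).1).resolve_left (neg_ne_zero.2 (hfpos p hp).ne')
  · exact (mul_eq_zero.1 (hcomp p hp).2.1).resolve_left (neg_ne_zero.2 (hfpos p hp).ne')
  · exact sub_eq_zero.1 ((mul_eq_zero.1 (hcomp p hp).2.2).resolve_left (hfpos p hp).ne')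

theorem IsUnitSpeedCurve.exists_geodCurv_ne_zero {m l : ℝ} {γ : ℝ → (Fin 2 → ℝ)} {I J : Set ℝ}
    {f : (Fin 2 → ℝ) → ℝ} (h : IsUnitSpeedCurve m γ I)
    (hf : ∀ {p}, p ∈ cylinderDomain I J → DifferentiableAt ℝ f p)
    (hf0 : ∀ p ∈ cylinderDomain I J, f p ≠ 0)
    (hnh : ¬ IsHarmonicMap (cylinderDomain I J) (rescaledMetric m l γ f) (bcvMetric m l)
      (hopfCylinder γ)) :
    ∃ s ∈ I, J.Nonempty ∧ geodCurv m γ s ≠ 0 := by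
  contrapose! hnh
  intro p hp
  rw [h.tension_hopfCylinder l hp.1 (hf hp) (hf0 p hp), normalTension,
    hnh _ hp.1 ⟨_, hp.2⟩]
  simp [frameVec]

/-- The equality `u_sz = u_zs` gives the first conclusion. -/
theorem mixed_partials_of_pd_eq {t a : ℝ → ℝ} {u : (Fin 2 → ℝ) → ℝ} {p : Fin 2 → ℝ}
    (hu : ContDiffAt ℝ 2 u p) (ht : DifferentiableAt ℝ t (p 0))
    (ha : DifferentiableAt ℝ a (p 0)) (h₀ : pd 0 u =ᶠ[nhds p] fun q => t (q 0) * pd 1 u q)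
    (h₁ : pd 1 u =ᶠ[nhds p] fun q => a (q 0) * u q) :
    deriv a (p 0) * u p = 0 ∧
      pd 0 (pd 0 u) p - t (p 0) * (pd 0 (pd 1 u) p + pd 1 (pd 0 u) p)
        + (1 + t (p 0) ^ 2) * pd 1 (pd 1 u) p - deriv t (p 0) * pd 1 u p =
      a (p 0) ^ 2 * u p := by
  have hcoord {b : ℝ → ℝ} (hb : DifferentiableAt ℝ b (p 0)) :
      DifferentiableAt ℝ (fun q : Fin 2 → ℝ => b (q 0)) p :=
    hb.comp p (f := fun q : Fin 2 → ℝ => q 0) (differentiableAt_apply 0 p)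
  have hz (i : Fin 2) : pd i (pd 1 u) p =
      a (p 0) * pd i u p + (if i = 0 then deriv a (p 0) else 0) * u p := by
    rw [pd_congr h₁, pd_mul (hcoord ha) (hu.differentiableAt two_ne_zero),
      pd_comp_coord ha.hasDerivAt]
  have hs (i : Fin 2) : pd i (pd 0 u) p =
      t (p 0) * pd i (pd 1 u) p + (if i = 0 then deriv t (p 0) else 0) * pd 1 u p := by
    rw [pd_congr h₀, pd_mul (hcoord ht) (differentiableAt_pd hu 1), pd_comp_coord ht.hasDerivAt]
  have hsymm := pd_comm hu 0 1
  simp only [hs, hz, h₀.eq_of_nhds, h₁.eq_of_nhds, ↓reduceIte, one_ne_zero] at hsymm ⊢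
  exact ⟨by linear_combination hsymm, by ring⟩

namespace BiharmonicSystem

variable {m l : ℝ} {t κ : ℝ → ℝ} {I J : Set ℝ} {f u : (Fin 2 → ℝ) → ℝ} {p : Fin 2 → ℝ} {s : ℝ}

theorem mem_nhds (h : BiharmonicSystem m l t κ I J f u) (hp : p ∈ cylinderDomain I J) :
    cylinderDomain I J ∈ nhds p :=
  (isOpen_cylinderDomain h.isOpen_left h.isOpen_right).mem_nhds hp

theorem contDiffOn (h : BiharmonicSystem m l t κ I J f u) :
    ContDiffOn ℝ ∞ u (cylinderDomain I J) :=
  h.eq_mul ▸ h.contDiffOn_factor.mul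
    (h.contDiffOn_curvature.comp (contDiff_apply ℝ ℝ (0 : Fin 2)).contDiffOn fun _ hq => hq.1)

theorem differentiableAt (h : BiharmonicSystem m l t κ I J f u) (hp : p ∈ cylinderDomain I J) :
    DifferentiableAt ℝ u p :=
  (h.contDiffOn.contDiffAt (h.mem_nhds hp)).differentiableAt (by simp)

theorem differentiableAt_factor (h : BiharmonicSystem m l t κ I J f u)
    (hp : p ∈ cylinderDomain I J) : DifferentiableAt ℝ f p :=
  (h.contDiffOn_factor.contDiffAt (h.mem_nhds hp)).differentiableAt (by simp)

theorem hasDerivAt_curvature (h : BiharmonicSystem m l t κ I J f u) (hs : s ∈ I) :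
    HasDerivAt κ (deriv κ s) s :=
  ((h.contDiffOn_curvature.contDiffAt (h.isOpen_left.mem_nhds hs)).differentiableAt
    (by simp)).hasDerivAt

theorem apply_ne_zero (h : BiharmonicSystem m l t κ I J f u) (hp : p ∈ cylinderDomain I J)
    (hκ : κ (p 0) ≠ 0) : u p ≠ 0 := by
  rw [h.eq_mul]
  exact mul_ne_zero (h.factor_pos p hp).ne' hκ

theorem pd_zero_eq (h : BiharmonicSystem m l t κ I J f u) (hl : l ≠ 0)
    (hp : p ∈ cylinderDomain I J) : pd 0 u p = t (p 0) * pd 1 u p :=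
  sub_eq_zero.1 ((mul_eq_zero.1 (h.tangential_vertical p hp)).resolve_left hl)

theorem pd_one_eq (h : BiharmonicSystem m l t κ I J f u) (hl : l ≠ 0)
    (hp : p ∈ cylinderDomain I J) : pd 1 u p = -deriv κ (p 0) / l * u p := by
  have htan := h.tangential_horizontal p hp
  rw [h.pd_zero_eq hl hp] at htan
  field_simp
  linarith

theorem differentiableAt_deriv_curvature (h : BiharmonicSystem m l t κ I J f u) (hs : s ∈ I) :
    DifferentiableAt ℝ (deriv κ) s :=
  ((h.contDiffOn_curvature.deriv_of_isOpen h.isOpen_left (m := ∞) (by simp)).contDiffAt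
    (h.isOpen_left.mem_nhds hs)).differentiableAt (by simp)

theorem deriv_deriv_curvature_and_sq (h : BiharmonicSystem m l t κ I J f u) (hl : l ≠ 0)
    (hJ : J.Nonempty) (hs : s ∈ I) (hκ : κ s ≠ 0) :
    deriv (deriv κ) s = 0 ∧ (deriv κ s / l) ^ 2 = κ s ^ 2 + l ^ 2 - 4 * m := by
  obtain ⟨z, hz⟩ := hJ
  have hp : ![s, z] ∈ cylinderDomain I J := ⟨hs, hz⟩
  have hne : u ![s, z] ≠ 0 := h.apply_ne_zero hp hκ
  have hκ' := h.differentiableAt_deriv_curvature hs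
  obtain ⟨hmixed, hop⟩ := mixed_partials_of_pd_eq (a := fun s => -deriv κ s / l)
    ((h.contDiffOn.contDiffAt (h.mem_nhds hp)).of_le ENat.LEInfty.out)
    (h.differentiableAt_tilt s hs) (hκ'.fun_neg.div_const l)
    (Filter.eventuallyEq_of_mem (h.mem_nhds hp) fun _ => h.pd_zero_eq hl)
    (Filter.eventuallyEq_of_mem (h.mem_nhds hp) fun _ => h.pd_one_eq hl)
  constructor
  · have hder := (mul_eq_zero.1 hmixed).resolve_right hne
    simpa [deriv_div_const, hl] using hder
  · have hsq := mul_right_cancel₀ hne (hop.symm.trans (h.normal _ hp))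
    simpa [neg_div] using hsq

theorem curvature_mul_deriv_eq_zero (h : BiharmonicSystem m l t κ I J f u) (hl : l ≠ 0)
    (hJ : J.Nonempty) (hs : s ∈ I) : κ s * deriv κ s = 0 := by
  by_cases hκ : κ s = 0
  · rw [hκ, zero_mul]
  have hsq : (fun r => (deriv κ r / l) ^ 2) =ᶠ[nhds s] fun r => κ r ^ 2 + l ^ 2 - 4 * m := by
    filter_upwards [h.isOpen_left.mem_nhds hs,
      (h.hasDerivAt_curvature hs).continuousAt.eventually_ne hκ] with r hr hκr
    exact (h.deriv_deriv_curvature_and_sq hl hJ hr hκr).2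
  have hder := (((h.differentiableAt_deriv_curvature hs).hasDerivAt.div_const l).fun_pow 2).unique
    (((((h.hasDerivAt_curvature hs).fun_pow 2).add_const (l ^ 2)).sub_const
      (4 * m)).congr_of_eventuallyEq hsq)
  rw [(h.deriv_deriv_curvature_and_sq hl hJ hs hκ).1] at hder
  push_cast at hder
  linear_combination -hder / 2

theorem deriv_curvature_eq_zero (h : BiharmonicSystem m l t κ I J f u) (hl : l ≠ 0)
    (hJ : J.Nonempty) (hκ : ∃ s ∈ I, κ s ≠ 0) (hs : s ∈ I) : deriv κ s = 0 := by
  obtain ⟨s₀, hs₀, hκ₀⟩ := hκ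
  have hsq : κ s ^ 2 = κ s₀ ^ 2 :=
    eq_of_hasDerivAt_zero h.isOpen_left h.ordConnected_left (g := fun s => κ s ^ 2)
      (fun r hr => ((h.hasDerivAt_curvature hr).fun_pow 2).congr_deriv (by
        push_cast
        linear_combination 2 * h.curvature_mul_deriv_eq_zero hl hJ hr)) hs hs₀
  have hne : κ s ≠ 0 := pow_ne_zero_iff two_ne_zero |>.1 (hsq ▸ pow_ne_zero 2 hκ₀)
  exact (mul_eq_zero.1 (h.curvature_mul_deriv_eq_zero hl hJ hs)).resolve_left hne

theorem exists_factor_eq_const (h : BiharmonicSystem m l t κ I J f u) (hl : l ≠ 0)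
    (hJ : J.Nonempty) (hκ : ∃ s ∈ I, κ s ≠ 0) : ∃ c, ∀ p ∈ cylinderDomain I J, f p = c := by
  have hκ' {s : ℝ} (hs : s ∈ I) : deriv κ s = 0 := h.deriv_curvature_eq_zero hl hJ hκ hs
  have hpd_one (p) (hp : p ∈ cylinderDomain I J) : pd 1 u p = 0 := by
    rw [h.pd_one_eq hl hp, hκ' hp.1, neg_zero, zero_div, zero_mul]
  have hpd_zero (p) (hp : p ∈ cylinderDomain I J) : pd 0 u p = 0 := by
    rw [h.pd_zero_eq hl hp, hpd_one p hp, mul_zero]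
  obtain ⟨c, hc⟩ := exists_const_of_pd_eq_zero
    (isOpen_cylinderDomain h.isOpen_left h.isOpen_right)
    (convex_cylinderDomain h.ordConnected_left h.ordConnected_right).isPreconnected
    (fun p hp => (h.differentiableAt hp).differentiableWithinAt)
    (fun p hp => Fin.forall_fin_two.2 ⟨hpd_zero p hp, hpd_one p hp⟩)
  obtain ⟨s₀, hs₀, hκ₀⟩ := hκ
  refine ⟨c / κ s₀, fun p hp => eq_div_of_mul_eq hκ₀ ?_⟩
  have hconst : κ (p 0) = κ s₀ := eq_of_hasDerivAt_zero h.isOpen_left h.ordConnected_left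
    (fun r hr => hκ' hr ▸ h.hasDerivAt_curvature hr) hp.1 hs₀
  simp only [← hc p hp, h.eq_mul, hconst]

theorem eq_zero_of_not_const (h : BiharmonicSystem m l t κ I J f u) (hJ : J.Nonempty)
    (hκ : ∃ s ∈ I, κ s ≠ 0) (hf : ¬ ∃ c, ∀ p ∈ cylinderDomain I J, f p = c) : l = 0 := by
  contrapose! hf
  exact h.exists_factor_eq_const hf hJ hκ

end BiharmonicSystem

/-! ### Separation of variables -/

section SeparationConstant

variable {I J : Set ℝ} {u : (Fin 2 → ℝ) → ℝ} {s z : ℝ}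

theorem hasSecondDerivOn_slice_zero (hI : IsOpen I) (hJ : IsOpen J)
    (hu : ContDiffOn ℝ ∞ u (cylinderDomain I J)) (hz : z ∈ J) :
    HasSecondDerivOn (fun s => u ![s, z]) (fun s => pd 0 (pd 0 u) ![s, z]) I := by
  have hU := isOpen_cylinderDomain hI hJ
  have hdiff {v : (Fin 2 → ℝ) → ℝ} (hv : ContDiffOn ℝ ∞ v (cylinderDomain I J)) (s) (hs : s ∈ I) :
      DifferentiableAt ℝ v ![s, z] :=
    (hv.contDiffAt (hU.mem_nhds ⟨hs, hz⟩)).differentiableAt (by simp)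
  exact .of_hasDerivAt hI (fun s hs => hasDerivAt_slice_zero (hdiff hu s hs))
    fun s hs => hasDerivAt_slice_zero (hdiff (contDiffOn_pd hU hu 0) s hs)

theorem hasSecondDerivOn_slice_one (hI : IsOpen I) (hJ : IsOpen J)
    (hu : ContDiffOn ℝ ∞ u (cylinderDomain I J)) (hs : s ∈ I) :
    HasSecondDerivOn (fun z => u ![s, z]) (fun z => pd 1 (pd 1 u) ![s, z]) J := by
  have hU := isOpen_cylinderDomain hI hJ
  have hdiff {v : (Fin 2 → ℝ) → ℝ} (hv : ContDiffOn ℝ ∞ v (cylinderDomain I J)) (z) (hz : z ∈ J) :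
      DifferentiableAt ℝ v ![s, z] :=
    (hv.contDiffAt (hU.mem_nhds ⟨hs, hz⟩)).differentiableAt (by simp)
  exact .of_hasDerivAt hJ (fun z hz => hasDerivAt_slice_one (hdiff hu z hz))
    fun z hz => hasDerivAt_slice_one (hdiff (contDiffOn_pd hU hu 1) z hz)

theorem exists_separation_constant {q w ψ : ℝ → ℝ} (hI : IsOpen I) (hJ : IsOpen J)
    (hs : s ∈ I) (hz : z ∈ J) (hw : w s ≠ 0) (hψ : ψ z ≠ 0)
    (hu : ContDiffOn ℝ ∞ u (cylinderDomain I J))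
    (hsep : ∀ s ∈ I, ∀ z ∈ J, u ![s, z] = ψ z * w s)
    (hpde : ∀ s ∈ I, ∀ z ∈ J,
      pd 0 (pd 0 u) ![s, z] + pd 1 (pd 1 u) ![s, z] = q s * u ![s, z]) :
    ∃ K, HasSecondDerivOn ψ (fun z => K * ψ z) J ∧
      HasSecondDerivOn w (fun s => (q s - K) * w s) I := by
  have hslice₀ {z} (hz : z ∈ J) := hasSecondDerivOn_slice_zero hI hJ hu hz
  have hslice₁ {s} (hs : s ∈ I) := hasSecondDerivOn_slice_one hI hJ hu hs
  obtain ⟨w₂, hw₂⟩ : ∃ w₂, HasSecondDerivOn w w₂ I :=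
    ⟨_, ((hslice₀ hz).const_mul hI (ψ z)⁻¹).congr hI
      (fun t ht => by rw [hsep t ht z hz, inv_mul_cancel_left₀ hψ]) fun _ _ => rfl⟩
  obtain ⟨ψ₂, hψ₂⟩ : ∃ ψ₂, HasSecondDerivOn ψ ψ₂ J :=
    ⟨_, ((hslice₁ hs).const_mul hJ (w s)⁻¹).congr hJ
      (fun t ht => by rw [hsep s hs t ht, mul_comm, mul_inv_cancel_right₀ hw]) fun _ _ => rfl⟩
  have hode (s) (hs : s ∈ I) (z) (hz : z ∈ J) :
      ψ z * w₂ s + w s * ψ₂ z = q s * (ψ z * w s) := by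
    have hu₀ := (hslice₀ hz).unique hI (hw₂.const_mul hI (ψ z)) (fun t ht => hsep t ht z hz) hs
    have hu₁ := (hslice₁ hs).unique hJ (hψ₂.const_mul hJ (w s))
      (fun t ht => (hsep s hs t ht).trans (mul_comm _ _)) hz
    rw [← hsep s hs z hz, ← hpde s hs z hz, hu₀, hu₁]
  obtain ⟨K, hK⟩ : ∃ K, ψ₂ z = K * ψ z := ⟨ψ₂ z / ψ z, (div_mul_cancel₀ _ hψ).symm⟩
  have hw₂_eq (t) (ht : t ∈ I) : w₂ t = (q t - K) * w t := by
    apply mul_left_cancel₀ hψ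
    linear_combination hode t ht z hz - w t * hK
  have hψ₂_eq (t) (ht : t ∈ J) : ψ₂ t = K * ψ t := by
    apply mul_left_cancel₀ hw
    linear_combination hode s hs t ht - ψ t * hw₂_eq s hs
  exact ⟨K, hψ₂.congr hJ (fun _ _ => rfl) hψ₂_eq, hw₂.congr hI (fun _ _ => rfl) hw₂_eq⟩

end SeparationConstant

/-- The separated form of the biharmonic equations for `l = 0`: the conformal factor is `ψ(z) w(s)³`
with `|κ| = w⁻²`, where `ψ` solves a linear equation and `w` an Ermakov equation with the common
separation constant `K`. -/
structure IsSeparated (m K : ℝ) (κ : ℝ → ℝ) (I J : Set ℝ) (f : (Fin 2 → ℝ) → ℝ)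
    (ψ w : ℝ → ℝ) : Prop where
  fibre_pos : ∀ z ∈ J, 0 < ψ z
  scale_pos : ∀ s ∈ I, 0 < w s
  abs_curvature : ∀ s ∈ I, |κ s| = 1 / w s ^ 2
  factor_eq : ∀ p ∈ cylinderDomain I J, f p = ψ (p 1) * w (p 0) ^ 3
  fibre_ode : HasSecondDerivOn ψ (fun z => K * ψ z) J
  scale_ode : HasSecondDerivOn w (fun s => (w s ^ 3)⁻¹ - (4 * m + K) * w s) I

namespace BiharmonicSystem

variable {m : ℝ} {κ : ℝ → ℝ} {I J : Set ℝ} {f u : (Fin 2 → ℝ) → ℝ} {s s₀ z z₀ : ℝ}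

theorem laplacian_eq (h : BiharmonicSystem m 0 0 κ I J f u) (hs : s ∈ I) (hz : z ∈ J) :
    pd 0 (pd 0 u) ![s, z] + pd 1 (pd 1 u) ![s, z] = (κ s ^ 2 - 4 * m) * u ![s, z] := by
  simpa using h.normal ![s, z] ⟨hs, hz⟩

theorem sq_mul_curvature_eq (h : BiharmonicSystem m 0 0 κ I J f u) (hs : s ∈ I) (hs₀ : s₀ ∈ I)
    (hz : z ∈ J) : u ![s, z] ^ 2 * κ s = u ![s₀, z] ^ 2 * κ s₀ := by
  refine eq_of_hasDerivAt_zero h.isOpen_left h.ordConnected_left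
    (g := fun s => u ![s, z] ^ 2 * κ s) (fun r hr => ?_) hs hs₀
  have hp : ![r, z] ∈ cylinderDomain I J := ⟨hr, hz⟩
  have htan : 2 * κ r * pd 0 u ![r, z] + deriv κ r * u ![r, z] = 0 := by
    simpa using h.tangential_horizontal _ hp
  refine (((hasDerivAt_slice_zero (h.differentiableAt hp)).fun_pow 2).mul
    (h.hasDerivAt_curvature hr)).congr_deriv ?_
  push_cast
  linear_combination u ![r, z] * htan

theorem curvature_ne_zero (h : BiharmonicSystem m 0 0 κ I J f u) (hs : s ∈ I) (hs₀ : s₀ ∈ I)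
    (hz : z ∈ J) (hκ : κ s₀ ≠ 0) : κ s ≠ 0 := by
  have hne : u ![s₀, z] ^ 2 * κ s₀ ≠ 0 :=
    mul_ne_zero (pow_ne_zero 2 (h.apply_ne_zero ⟨hs₀, hz⟩ hκ)) hκ
  exact right_ne_zero_of_mul (h.sq_mul_curvature_eq hs hs₀ hz ▸ hne)

theorem exists_curvature_eq_mul_abs (h : BiharmonicSystem m 0 0 κ I J f u) (hs₀ : s₀ ∈ I)
    (hz : z ∈ J) (hκ : κ s₀ ≠ 0) : ∃ σ ≠ 0, ∀ s ∈ I, κ s = σ * |κ s| := by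
  have habs₀ : |κ s₀| ≠ 0 := abs_ne_zero.2 hκ
  refine ⟨κ s₀ / |κ s₀|, div_ne_zero hκ habs₀, fun s hs => ?_⟩
  have hsq := h.sq_mul_curvature_eq hs hs₀ hz
  have hsq_abs := congrArg abs hsq
  rw [abs_mul, abs_mul, abs_sq, abs_sq] at hsq_abs
  have hu : u ![s, z] ≠ 0 := h.apply_ne_zero ⟨hs, hz⟩ (h.curvature_ne_zero hs hs₀ hz hκ)
  rw [div_mul_eq_mul_div, eq_div_iff habs₀]
  apply mul_left_cancel₀ (pow_ne_zero 2 hu)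
  linear_combination |κ s₀| * hsq - κ s₀ * hsq_abs

theorem factor_mul_sqrt_cube_eq (h : BiharmonicSystem m 0 0 κ I J f u) (hs : s ∈ I)
    (hs₀ : s₀ ∈ I) (hz : z ∈ J) :
    f ![s, z] * √|κ s| ^ 3 = f ![s₀, z] * √|κ s₀| ^ 3 := by
  have hsq (r : ℝ) : (f ![r, z] * √|κ r| ^ 3) ^ 2 = |u ![r, z] ^ 2 * κ r| := by
    rw [mul_pow, pow_right_comm, Real.sq_sqrt (abs_nonneg _), h.eq_mul, abs_mul, abs_sq]
    simp only [Matrix.cons_val_zero, mul_pow, ← sq_abs (κ r)]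
    ring
  have hnonneg {r} (hr : r ∈ I) : 0 ≤ f ![r, z] * √|κ r| ^ 3 :=
    mul_nonneg (h.factor_pos _ ⟨hr, hz⟩).le (by positivity)
  rw [← pow_left_inj₀ (hnonneg hs) (hnonneg hs₀) two_ne_zero, hsq, hsq,
    h.sq_mul_curvature_eq hs hs₀ hz]

theorem exists_isSeparated (h : BiharmonicSystem m 0 0 κ I J f u) (hs₀ : s₀ ∈ I) (hz₀ : z₀ ∈ J)
    (hκ₀ : κ s₀ ≠ 0) : ∃ K ψ w, IsSeparated m K κ I J f ψ w := by
  have hr (s) (hs : s ∈ I) : 0 < √|κ s| :=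
    Real.sqrt_pos.2 (abs_pos.2 (h.curvature_ne_zero hs hs₀ hz₀ hκ₀))
  have habs (s : ℝ) : √|κ s| ^ 2 = |κ s| := Real.sq_sqrt (abs_nonneg _)
  set w : ℝ → ℝ := fun s => (√|κ s|)⁻¹
  set ψ : ℝ → ℝ := fun z => f ![s₀, z] * √|κ s₀| ^ 3
  obtain ⟨σ, hσ, hκσ⟩ := h.exists_curvature_eq_mul_abs hs₀ hz₀ hκ₀
  have hw (s) (hs : s ∈ I) : 0 < w s := inv_pos.2 (hr s hs)
  have hψ (z) (hz : z ∈ J) : 0 < ψ z :=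
    mul_pos (h.factor_pos _ ⟨hs₀, hz⟩) (pow_pos (hr s₀ hs₀) 3)
  have hfactor (s) (hs : s ∈ I) (z) (hz : z ∈ J) : f ![s, z] = ψ z * w s ^ 3 := by
    rw [inv_pow, ← div_eq_mul_inv, eq_div_iff (pow_pos (hr s hs) 3).ne',
      h.factor_mul_sqrt_cube_eq hs hs₀ hz]
  have husep (s) (hs : s ∈ I) (z) (hz : z ∈ J) : u ![s, z] = σ * ψ z * w s := by
    have hrs := (hr s hs).ne'
    calc u ![s, z] = f ![s, z] * κ s := congrFun h.eq_mul _
      _ = ψ z * (√|κ s|)⁻¹ ^ 3 * (σ * √|κ s| ^ 2) := by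
        rw [hfactor s hs z hz, habs, ← hκσ s hs]
      _ = σ * ψ z * w s := by simp only [w]; field_simp
  obtain ⟨K, hψK, hwK⟩ := exists_separation_constant (ψ := fun z => σ * ψ z)
    (q := fun s => κ s ^ 2 - 4 * m) h.isOpen_left h.isOpen_right hs₀ hz₀ (hw s₀ hs₀).ne'
    (mul_ne_zero hσ (hψ z₀ hz₀).ne') h.contDiffOn husep fun s hs z hz => h.laplacian_eq hs hz
  refine ⟨K, ψ, w, hψ, hw, fun s _ => by simp only [w, inv_pow, habs, one_div, inv_inv],
    fun p hp => ?_, ?_, hwK.congr h.isOpen_left (fun _ _ => rfl) fun s hs => ?_⟩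
  · rw [← hfactor _ hp.1 _ hp.2]
    exact congrArg f (by ext i; fin_cases i <;> rfl)
  · exact (hψK.const_mul h.isOpen_right σ⁻¹).congr h.isOpen_right
      (fun z _ => (inv_mul_cancel_left₀ hσ _).symm) fun z _ => by field_simp
  · have hrs := (hr s hs).ne'
    rw [← sq_abs, ← habs]
    simp only [w]
    field_simp
    ring

end BiharmonicSystem

/-! ### Classification of the separated solutions -/

section Classification

variable {m k K : ℝ} {κ ψ w : ℝ → ℝ} {I J : Set ℝ} {f : (Fin 2 → ℝ) → ℝ}

namespace IsSeparated

theorem scale_eq_of_curvature_eq (h : IsSeparated m K κ I J f ψ w) {s s₀ : ℝ} (hs : s ∈ I)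
    (hs₀ : s₀ ∈ I) (hκ : κ s = κ s₀) : w s = w s₀ := by
  have hsq : w s ^ 2 = w s₀ ^ 2 := by
    have habs := h.abs_curvature s hs
    rw [hκ, h.abs_curvature s₀ hs₀, one_div, one_div] at habs
    exact (inv_injective habs).symm
  exact (pow_left_inj₀ (h.scale_pos s hs).le (h.scale_pos s₀ hs₀).le two_ne_zero).1 hsq

theorem eq_sq_sub (h : IsSeparated m K κ I J f ψ w) (hI : IsOpen I) (hne : I.Nonempty)
    (hκ : ∀ s ∈ I, κ s = k) : K = k ^ 2 - 4 * m := by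
  obtain ⟨s₀, hs₀⟩ := hne
  have hconst : HasSecondDerivOn (fun _ => w s₀) 0 I := .of_hasDerivAt hI (y' := 0)
    (fun s _ => hasDerivAt_const s _) fun s _ => hasDerivAt_const s _
  have hode := h.scale_ode.unique hI hconst
    (fun s hs => h.scale_eq_of_curvature_eq hs hs₀ ((hκ s hs).trans (hκ s₀ hs₀).symm)) hs₀
  have hw₀ := (h.scale_pos s₀ hs₀).ne'
  have hk : k ^ 2 = 1 / w s₀ ^ 4 := by
    rw [← hκ s₀ hs₀, ← sq_abs, h.abs_curvature s₀ hs₀]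
    ring
  rw [hk]
  simp only [Pi.zero_apply] at hode
  field_simp at hode ⊢
  linear_combination -hode

theorem exists_fibre_factor (h : IsSeparated m K κ I J f ψ w) (hI : IsOpen I) (hne : I.Nonempty)
    (hJ : IsOpen J) (hκ : ∀ s ∈ I, κ s = k) :
    ∃ Ψ : ℝ → ℝ, (∀ z ∈ J, 0 < Ψ z) ∧ HasSecondDerivOn Ψ (fun z => (k ^ 2 - 4 * m) * Ψ z) J ∧
      ∀ p ∈ cylinderDomain I J, f p = Ψ (p 1) := by
  have hK := h.eq_sq_sub hI hne hκ
  obtain ⟨s₀, hs₀⟩ := hne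
  refine ⟨fun z => w s₀ ^ 3 * ψ z,
    fun z hz => mul_pos (pow_pos (h.scale_pos s₀ hs₀) 3) (h.fibre_pos z hz), ?_, fun p hp => ?_⟩
  · exact (h.fibre_ode.const_mul hJ _).congr hJ (fun _ _ => rfl) fun z _ => by rw [← hK]; ring
  · rw [h.factor_eq p hp, mul_comm,
      h.scale_eq_of_curvature_eq hp.1 hs₀ ((hκ _ hp.1).trans (hκ s₀ hs₀).symm)]

theorem factor_eq_mul_rpow (h : IsSeparated m K κ I J f ψ w) {p : Fin 2 → ℝ}
    (hp : p ∈ cylinderDomain I J) : f p = ψ (p 1) * |κ (p 0)| ^ (-(3 / 2) : ℝ) := by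
  have hw := h.scale_pos _ hp.1
  rw [h.factor_eq p hp, h.abs_curvature _ hp.1, one_div, Real.inv_rpow (sq_nonneg _),
    Real.rpow_neg (sq_nonneg _), inv_inv, ← Real.rpow_natCast, ← Real.rpow_natCast,
    ← Real.rpow_mul hw.le]
  norm_num

end IsSeparated

theorem HasSecondDerivOn.exists_eq_exp_of_pos (h : HasSecondDerivOn ψ (fun z => K * ψ z) J)
    (hJ : IsOpen J) (hJ' : J.OrdConnected) (hne : J.Nonempty) (hK : 0 < K)
    (hpos : ∀ z ∈ J, 0 < ψ z) :
    ∃ d₁ d₂ : ℝ, d₁ ^ 2 + d₂ ^ 2 ≠ 0 ∧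
      ∀ z ∈ J, ψ z = d₁ * Real.exp (z * √K) + d₂ * Real.exp (-(z * √K)) := by
  rw [← Real.sq_sqrt hK.le] at h
  obtain ⟨a, b, hab⟩ := h.exists_eq_exp hJ hJ' hne (Real.sqrt_pos.2 hK).ne'
  refine ⟨a, b, fun hzero => ?_, fun z hz => mul_comm z √K ▸ (hab z hz).1⟩
  obtain ⟨ha, hb⟩ := (add_eq_zero_iff_of_nonneg (sq_nonneg a) (sq_nonneg b)).1 hzero
  obtain ⟨z, hz⟩ := hne
  refine (hpos z hz).ne' ?_
  rw [(hab z hz).1, pow_eq_zero_iff two_ne_zero |>.1 ha, pow_eq_zero_iff two_ne_zero |>.1 hb]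
  ring

theorem IsFibreSolution.ne_univ (h : IsFibreSolution K J ψ) (hK : K ≤ 0)
    (hpos : ∀ z ∈ J, 0 < ψ z) (hnc : ¬ ∃ c, ∀ z ∈ J, ψ z = c) : J ≠ Set.univ := by
  rintro rfl
  obtain ⟨c, hc⟩ := h.exists_eq_of_pos hK fun z => hpos z trivial
  exact hnc ⟨c, fun z _ => hc z⟩

end Classification

end HopfBCV

end

theorem mainTheorem3 (m l : ℝ) (I J : Set ℝ)
    (hI : IsOpen I) (hI' : I.OrdConnected) (hJ : IsOpen J) (hJ' : J.OrdConnected)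
    (γ : ℝ → (Fin 2 → ℝ)) (hγ : ContDiffOn ℝ ∞ γ I)
    (hF : ∀ s ∈ I, HopfBCV.conf m (γ s 0) (γ s 1) ≠ 0)
    (hunit : ∀ s ∈ I, HopfBCV.ip (HopfBCV.baseMetric m) (γ s)
      (HopfBCV.vel γ s) (HopfBCV.vel γ s) = 1)
    (f : (Fin 2 → ℝ) → ℝ)
    (hf : ContDiffOn ℝ ∞ f (HopfBCV.cylinderDomain I J))
    (hfpos : ∀ p ∈ HopfBCV.cylinderDomain I J, 0 < f p)
    (hfnonconst : ¬ ∃ c : ℝ, ∀ p ∈ HopfBCV.cylinderDomain I J, √(f p) = c)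
    (hbi : HopfBCV.IsProperBiharmonicMap (HopfBCV.cylinderDomain I J)
      (fun p => (f p)⁻¹ •
        HopfBCV.pullbackMetric (HopfBCV.bcvMetric m l) (HopfBCV.hopfCylinder γ) p)
      (HopfBCV.bcvMetric m l) (HopfBCV.hopfCylinder γ)) :
    l = 0 ∧
    (∀ p ∈ HopfBCV.cylinderDomain I J,
      HopfBCV.meanCurvature (HopfBCV.bcvMetric m l) (HopfBCV.hopfCylinder γ)
        (HopfBCV.hopfNormal m l γ) p = HopfBCV.geodCurv m γ (p 0) / 2) ∧
    ((∃ k : ℝ, k ≠ 0 ∧ (∀ s ∈ I, HopfBCV.geodCurv m γ s = k) ∧ 0 < k ^ 2 - 4 * m ∧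
        ∃ d₁ d₂ : ℝ, d₁ ^ 2 + d₂ ^ 2 ≠ 0 ∧ ∀ p ∈ HopfBCV.cylinderDomain I J,
          f p = d₁ * Real.exp (p 1 * √(k ^ 2 - 4 * m))
            + d₂ * Real.exp (-(p 1 * √(k ^ 2 - 4 * m)))) ∨
      ((¬ ∃ k : ℝ, ∀ s ∈ I, HopfBCV.geodCurv m γ s = k) ∧
        (∀ s ∈ I, HopfBCV.geodCurv m γ s ≠ 0) ∧
        ∃ (K : ℝ) (ψ : ℝ → ℝ), (∀ z ∈ J, 0 < ψ z) ∧
          HopfBCV.IsFibreSolution K J ψ ∧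
          HopfBCV.IsCurvatureSolution m K I (fun s => |HopfBCV.geodCurv m γ s|) ∧
          ∀ p ∈ HopfBCV.cylinderDomain I J,
            f p = ψ (p 1) * |HopfBCV.geodCurv m γ (p 0)| ^ (-(3 / 2) : ℝ)) ∨
      (J ≠ Set.univ ∧
        ∃ k : ℝ, k ≠ 0 ∧ (∀ s ∈ I, HopfBCV.geodCurv m γ s = k) ∧ k ^ 2 - 4 * m ≤ 0 ∧
          ∃ ψ : ℝ → ℝ, HopfBCV.IsFibreSolution (k ^ 2 - 4 * m) J ψ ∧
            ∀ p ∈ HopfBCV.cylinderDomain I J, f p = ψ (p 1))) := by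
  have h : HopfBCV.IsUnitSpeedCurve m γ I := ⟨hI, hγ, hF, hunit⟩
  have hsys := h.biharmonicSystem hI' hJ hJ' hf hfpos hbi.1
  have hf_not_const : ¬ ∃ c, ∀ p ∈ HopfBCV.cylinderDomain I J, f p = c :=
    fun ⟨c, hc⟩ => hfnonconst ⟨√c, fun p hp => by rw [hc p hp]⟩
  obtain ⟨s₀, hs₀, ⟨z₀, hz₀⟩, hκ₀⟩ := h.exists_geodCurv_ne_zero hsys.differentiableAt_factor
    (fun p hp => (hfpos p hp).ne') hbi.2
  obtain rfl : l = 0 := hsys.eq_zero_of_not_const ⟨z₀, hz₀⟩ ⟨s₀, hs₀, hκ₀⟩ hf_not_const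
  refine ⟨rfl, fun p hp => h.meanCurvature_hopfCylinder 0 hp.1, ?_⟩
  rw [HopfBCV.tilt_zero] at hsys
  obtain ⟨K, ψ, w, hsep⟩ := hsys.exists_isSeparated hs₀ hz₀ hκ₀
  by_cases hconst : ∃ k, ∀ s ∈ I, HopfBCV.geodCurv m γ s = k
  · obtain ⟨k, hk⟩ := hconst
    have hk₀ : k ≠ 0 := hk s₀ hs₀ ▸ hκ₀
    obtain ⟨Ψ, hΨpos, hΨ, hfΨ⟩ := hsep.exists_fibre_factor hI ⟨s₀, hs₀⟩ hJ hk
    rcases lt_or_ge 0 (k ^ 2 - 4 * m) with hpos | hnonpos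
    · obtain ⟨d₁, d₂, hd, hexp⟩ := hΨ.exists_eq_exp_of_pos hJ hJ' ⟨z₀, hz₀⟩ hpos hΨpos
      exact .inl ⟨k, hk₀, hk, hpos, d₁, d₂, hd, fun p hp => (hfΨ p hp).trans (hexp _ hp.2)⟩
    · have hsol := hΨ.isFibreSolution hJ hJ' ⟨z₀, hz₀⟩
      have hJ_ne_univ := hsol.ne_univ hnonpos hΨpos fun ⟨c, hc⟩ =>
        hf_not_const ⟨c, fun p hp => (hfΨ p hp).trans (hc _ hp.2)⟩
      exact .inr (.inr ⟨hJ_ne_univ, k, hk₀, hk, hnonpos, Ψ, hsol, hfΨ⟩)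
  · exact .inr (.inl ⟨hconst, fun s hs => hsys.curvature_ne_zero hs hs₀ hz₀ hκ₀, K, ψ,
      hsep.fibre_pos, hsep.fibre_ode.isFibreSolution hJ hJ' ⟨z₀, hz₀⟩,
      HopfBCV.isCurvatureSolution_of_ermakov hI hI' ⟨s₀, hs₀⟩ hsep.scale_pos hsep.abs_curvature
        hsep.scale_ode, fun p hp => hsep.factor_eq_mul_rpow hp⟩)
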